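/- Let $N\in\mathbb N$, $1<p<N$ and $C_0,C_1>0$. For $r>0$ let $K_r=\{x\in\mathbb R^N: |x_i|<r/2,\ i=1,\dots,N\}$ be the cube of side $r$ centred at the origin, and write $P(K;\,u\ge k)=|K\cap\{u\ge k\}|/|K|$. A function $u\in W^{1,p}_{\rm loc}(K_R)$ is called a supersolution in $K_R$ if there is $A:K_R\times\mathbb R\times\mathbb R^N\to\mathbb R^N$, with $x\mapsto A(x,u(x),Du(x))$ measurable, satisfying \[ A(x,s,z)\cdot z\ge C_0|z|^p,\qquad |A(x,s,z)|\le C_1|z|^{p-1}\qquad\text{for a.e. }x\in K_R\text{ and all }s\in\mathbb R,\ z\in\mathbb R^N, \] such that $-\operatorname{div}A(x,u,Du)\ge 0$ weakly in $K_R$, i.e. $\int_{K_R}A(x,u,Du)\cdot D\varphi\,dx\ge 0$ for all $0\le\varphi\in C^\infty_c(K_R)$. Theorem (Expansion of positivity, elliptic case). There is a constant $\bar\lambda>1$ depending only on $N,p,C_0,C_1$ and, for each $\mu>0$, a constant $c(\mu)>0$ depending only on $\mu,N,p,C_0,C_1$, such that for every $R>0$, every supersolution $u$ in $K_R$ with $u\ge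 0$ a.e. in $K_R$, and all $0<r\le\rho\le R/2$, \[ P(K_r;\,u\ge 1)\ge\mu\quad\Longrightarrow\quad \operatorname*{ess\,inf}_{K_\rho}u\ge c(\mu)\,(r/\rho)^{\bar\lambda}. \] -/

import Mathlib

open MeasureTheory Set
open scoped ContDiff Gradient RealInnerProductSpace

/-- The open cube of side `r` centred at the origin of `ℝ^N`. -/
def cube (N : ℕ) (r : ℝ) : Set (EuclideanSpace ℝ (Fin N)) :=
  {x | ∀ i, |x i| < r / 2}

/-- The fraction `P(K; u ≥ k)` of the set `K` on which `u ≥ k`. -/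
noncomputable def superlevelFraction {N : ℕ} (K : Set (EuclideanSpace ℝ (Fin N)))
    (u : EuclideanSpace ℝ (Fin N) → ℝ) (k : ℝ) : ℝ :=
  volume.real (K ∩ {x | k ≤ u x}) / volume.real K

/-- `f ∈ L^p_loc(Ω)`: `f` is in `L^p` of every compact subset of `Ω`. -/
def MemLpLoc {N : ℕ} {F : Type*} [NormedAddCommGroup F]
    (Ω : Set (EuclideanSpace ℝ (Fin N))) (p : ℝ) (f : EuclideanSpace ℝ (Fin N) → F) : Prop :=
  ∀ K : Set (EuclideanSpace ℝ (Fin N)), IsCompact K → K ⊆ Ω →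
    MemLp f (ENNReal.ofReal p) (volume.restrict K)

/-- `φ ∈ C_c^∞(Ω)`. -/
structure IsTestFunction {N : ℕ} (Ω : Set (EuclideanSpace ℝ (Fin N)))
    (φ : EuclideanSpace ℝ (Fin N) → ℝ) : Prop where
  contDiff : ContDiff ℝ ∞ φ
  hasCompactSupport : HasCompactSupport φ
  tsupport_subset : tsupport φ ⊆ Ω

/-- `u ∈ W^{1,p}_loc(Ω)` with weak gradient `Du`. -/
structure HasSobolevGradient {N : ℕ} (Ω : Set (EuclideanSpace ℝ (Fin N))) (p : ℝ)
    (u : EuclideanSpace ℝ (Fin N) → ℝ)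
    (Du : EuclideanSpace ℝ (Fin N) → EuclideanSpace ℝ (Fin N)) : Prop where
  memLpLoc : MemLpLoc Ω p u
  memLpLoc_grad : MemLpLoc Ω p Du
  integral_by_parts : ∀ φ : EuclideanSpace ℝ (Fin N) → ℝ, IsTestFunction Ω φ →
    ∫ x in Ω, u x • ∇ φ x = - ∫ x in Ω, φ x • Du x

/-- The growth conditions `A(x,s,z) · z ≥ C₀ |z|^p` and `|A(x,s,z)| ≤ C₁ |z|^(p-1)`
for almost every `x ∈ Ω` and all `s`, `z`. -/
def HasPGrowth {N : ℕ} (Ω : Set (EuclideanSpace ℝ (Fin N))) (p C₀ C₁ : ℝ)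
    (A : EuclideanSpace ℝ (Fin N) → ℝ → EuclideanSpace ℝ (Fin N) →
      EuclideanSpace ℝ (Fin N)) : Prop :=
  ∀ᵐ x ∂volume.restrict Ω, ∀ (s : ℝ) (z : EuclideanSpace ℝ (Fin N)),
    C₀ * ‖z‖ ^ p ≤ ⟪A x s z, z⟫ ∧ ‖A x s z‖ ≤ C₁ * ‖z‖ ^ (p - 1)

/-- `u ∈ W^{1,p}_loc(Ω)` is a weak supersolution in `Ω` of the `p`-growth equation: for some `A`
with the prescribed growth, `-div A(x, u, Du) ≥ 0` weakly in `Ω`. Of the field `A(x, u, Du)` only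
measurability is required, which holds whenever `A` is Borel measurable or Carathéodory; the growth
condition then makes it locally integrable. -/
def IsSupersolution {N : ℕ} (Ω : Set (EuclideanSpace ℝ (Fin N))) (p C₀ C₁ : ℝ)
    (u : EuclideanSpace ℝ (Fin N) → ℝ) : Prop :=
  ∃ A : EuclideanSpace ℝ (Fin N) → ℝ → EuclideanSpace ℝ (Fin N) → EuclideanSpace ℝ (Fin N),
    HasPGrowth Ω p C₀ C₁ A ∧
    ∃ Du : EuclideanSpace ℝ (Fin N) → EuclideanSpace ℝ (Fin N),
      HasSobolevGradient Ω p u Du ∧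
      AEStronglyMeasurable (fun x => A x (u x) (Du x)) (volume.restrict Ω) ∧
      ∀ φ : EuclideanSpace ℝ (Fin N) → ℝ, IsTestFunction Ω φ → (∀ x, 0 ≤ φ x) →
        0 ≤ ∫ x in Ω, ⟪A x (u x) (Du x), ∇ φ x⟫

/-! The core is a statement at a single scale, `exists_expansion_of_positivity`: if `u ≥ t` on a
fraction `ν` of `K_r`, then `u ≥ c t` a.e. on that same cube, with `c` depending only on `ν` and the
data. Since `r ≤ R/2`, the cube `K_{7r/4}` is compactly contained in `K_R` and leaves room for
cutoffs.

Two estimates give this. Testing with `ζ (u + k)^(1-p)` bounds the integral of `|D log(u + k)|^p`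
independently of `u` and `k`. A Poincaré inequality turns this into `exists_log_estimate`: the
measures of `{u ≥ t}` and `{u < k}`, multiplied together and by roughly `log (t/k)`, stay below `C
r^(2N)`. So for `k = ε t` with `ε` small, `{u < ε t}` occupies as small a fraction as desired. Once
this fraction is below a critical density, De Giorgi iteration, `exists_deGiorgi`, gives `u ≥ ε t /
2` a.e. on `K_r`.

Positivity then spreads by doubling: a lower bound on all of `K_s` is a lower bound on the fraction
`2^(-N)` of `K_{2s}`, so each doubling costs one fixed factor `c₀`. About `log₂(ρ/r)` doublings cost
a power of `r/ρ` with exponent `log₂(1/c₀)`. The number `μ` enters only through the first step, so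
it affects the constant but not the exponent.

Both estimates test the equation with `ζ g(u)`, while only smooth test functions are admissible.
`IsRegularizedSupersolution` packages a nonnegative representative with smooth nonnegative
approximations; products `ζ g(w n)`, with `g` smooth on `[0, ∞)`, are admissible and pass to the
limit. The truncation `(k - u)₊` is replaced by the flat function `e^(-1/x)`. One inequality,
`IsRegularizedSupersolution.lintegral_energy_le`, serves both choices of `g`: it needs `g`
nonincreasing with `g ≤ M (-g')^((p-1)/p)`. -/

open Filter Topology ENNReal Convolution

/-! ### Mollification in `L^p` -/

section Mollification

variable {G F : Type*} [NormedAddCommGroup G] [InnerProductSpace ℝ G] [MeasurableSpace G]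
  [BorelSpace G] [FiniteDimensional ℝ G] [NormedAddCommGroup F] [NormedSpace ℝ F]

/-- Young's inequality for the convolution with a normalized bump function. -/
theorem eLpNorm_normed_convolution_le {μ : Measure G} [μ.IsAddHaarMeasure]
    (φ : ContDiffBump (0 : G)) {h : G → F} (hm : StronglyMeasurable h) {p : ℝ} (hp : 1 ≤ p) :
    eLpNorm (φ.normed μ ⋆[ContinuousLinearMap.lsmul ℝ ℝ, μ] h) (ENNReal.ofReal p) μ ≤
      eLpNorm h (ENNReal.ofReal p) μ := by
  have hp0 : 0 < p := by linarith
  have hp1 : ENNReal.ofReal p ≠ 0 := by simpa using hp0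
  have hφm : Measurable fun t => ENNReal.ofReal (φ.normed μ t) :=
    (φ.continuous_normed (μ := μ)).measurable.ennreal_ofReal
  -- With the kernel as a probability measure, Jensen's inequality becomes monotonicity of
  -- `eLpNorm'` in the exponent.
  set m : Measure G := μ.withDensity fun t => ENNReal.ofReal (φ.normed μ t) with hmdef
  have hprob : IsProbabilityMeasure m := by
    constructor
    rw [hmdef, withDensity_apply _ MeasurableSet.univ, Measure.restrict_univ,
      ← ofReal_integral_eq_lintegral_ofReal φ.integrable_normed
        (Eventually.of_forall φ.nonneg_normed), φ.integral_normed, ENNReal.ofReal_one]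
  have hh : Measurable fun q : G × G => ‖h (q.1 - q.2)‖ₑ ^ p :=
    ((hm.comp_measurable (measurable_fst.sub measurable_snd)).enorm).pow_const p
  have key : ∀ x, ‖(φ.normed μ ⋆[ContinuousLinearMap.lsmul ℝ ℝ, μ] h) x‖ₑ ^ p ≤
      ∫⁻ t, ‖h (x - t)‖ₑ ^ p ∂m := by
    intro x
    have hx : StronglyMeasurable fun t => h (x - t) :=
      hm.comp_measurable (measurable_const.sub measurable_id)
    have h1 : ‖(φ.normed μ ⋆[ContinuousLinearMap.lsmul ℝ ℝ, μ] h) x‖ₑ ≤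
        eLpNorm' (fun t => h (x - t)) 1 m := by
      rw [convolution_lsmul, eLpNorm'_eq_lintegral_enorm]
      refine (enorm_integral_le_lintegral_enorm _).trans (le_of_eq ?_)
      simp only [one_div, inv_one, ENNReal.rpow_one]
      rw [lintegral_withDensity_eq_lintegral_mul _ hφm hx.enorm]
      refine lintegral_congr fun t => ?_
      rw [enorm_smul, Pi.mul_apply, Real.enorm_eq_ofReal (φ.nonneg_normed t)]
    have h2 := h1.trans (eLpNorm'_le_eLpNorm'_of_exponent_le one_pos hp m hx.aestronglyMeasurable)
    calc _ ≤ (eLpNorm' (fun t => h (x - t)) p m) ^ p := by gcongr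
      _ = _ := by
        rw [eLpNorm'_eq_lintegral_enorm, ← ENNReal.rpow_mul, one_div_mul_cancel hp0.ne',
          ENNReal.rpow_one]
  rw [eLpNorm_eq_lintegral_rpow_enorm_toReal hp1 ENNReal.ofReal_ne_top,
    eLpNorm_eq_lintegral_rpow_enorm_toReal hp1 ENNReal.ofReal_ne_top, ENNReal.toReal_ofReal hp0.le]
  gcongr ?_ ^ (1 / p)
  calc _ ≤ ∫⁻ x, ∫⁻ t, ‖h (x - t)‖ₑ ^ p ∂m ∂μ := lintegral_mono key
    _ = ∫⁻ t, ∫⁻ x, ‖h (x - t)‖ₑ ^ p ∂μ ∂m := lintegral_lintegral_swap hh.aemeasurable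
    _ = ∫⁻ t, ∫⁻ x, ‖h x‖ₑ ^ p ∂μ ∂m :=
      lintegral_congr fun t => lintegral_sub_right_eq_self (fun x => ‖h x‖ₑ ^ p) t
    _ = _ := by simp

/-- Mollifications of an `L^p` function converge in `L^p` on sets of finite measure. -/
theorem tendsto_eLpNorm_normed_convolution_sub [CompleteSpace F]
    {μ : Measure G} [μ.IsAddHaarMeasure] {φ : ℕ → ContDiffBump (0 : G)}
    (hφ : Tendsto (fun n => (φ n).rOut) atTop (𝓝 0)) {p : ℝ} (hp : 1 ≤ p) {f : G → F}
    (hfm : StronglyMeasurable f) (hf : MemLp f (ENNReal.ofReal p) μ) {K : Set G} (hK : μ K ≠ ⊤) :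
    Tendsto (fun n => eLpNorm (((φ n).normed μ ⋆[ContinuousLinearMap.lsmul ℝ ℝ, μ] f) - f)
      (ENNReal.ofReal p) (μ.restrict K)) atTop (𝓝 0) := by
  have hp1 : (1 : ℝ≥0∞) ≤ ENNReal.ofReal p := by simpa using hp
  rw [ENNReal.tendsto_nhds_zero]
  intro ε hε
  have hε3 : ε / 3 ≠ 0 := by simp [hε.ne']
  obtain ⟨g, hgc, hfg, hg, hgp⟩ := hf.exists_hasCompactSupport_eLpNorm_sub_le
    ENNReal.ofReal_ne_top hε3
  have hgi : LocallyIntegrable g μ := hg.locallyIntegrable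
  have hfi : LocallyIntegrable f μ := hf.locallyIntegrable hp1
  obtain ⟨η, hη, hηK⟩ : ∃ η : ℝ, 0 < η ∧
      (μ K) ^ (ENNReal.ofReal p).toReal⁻¹ * ENNReal.ofReal η ≤ ε / 3 := by
    have hM : (μ K) ^ (ENNReal.ofReal p).toReal⁻¹ ≠ ⊤ :=
      ENNReal.rpow_ne_top_of_nonneg (by positivity) hK
    have h0 : Tendsto (fun η : ℝ => (μ K) ^ (ENNReal.ofReal p).toReal⁻¹ * ENNReal.ofReal η)
        (𝓝[>] 0) (𝓝 0) := by
      have := ENNReal.Tendsto.const_mul (a := (μ K) ^ (ENNReal.ofReal p).toReal⁻¹)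
        (ENNReal.tendsto_ofReal (tendsto_id (α := ℝ) (x := 𝓝 0))) (Or.inr hM)
      simp only [ENNReal.ofReal_zero, mul_zero] at this
      exact this.mono_left nhdsWithin_le_nhds
    obtain ⟨η, h1, h2⟩ := ((ENNReal.tendsto_nhds_zero.1 h0 (ε / 3) (pos_iff_ne_zero.2 hε3)).and
      self_mem_nhdsWithin).exists
    exact ⟨η, h2, h1⟩
  obtain ⟨δ, hδ, hδg⟩ := Metric.uniformContinuous_iff.1
    (hgc.uniformContinuous_of_continuous hg) η hη
  filter_upwards [hφ.eventually (gt_mem_nhds hδ)] with n hn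
  set c : (G → F) → G → F := fun h => (φ n).normed μ ⋆[ContinuousLinearMap.lsmul ℝ ℝ, μ] h
  have hcs : HasCompactSupport ((φ n).normed μ) := (φ n).hasCompactSupport_normed
  have hce : ∀ {h : G → F}, LocallyIntegrable h μ → ConvolutionExists ((φ n).normed μ) h
      (ContinuousLinearMap.lsmul ℝ ℝ) μ := fun h =>
    hcs.convolutionExists_left _ (φ n).continuous_normed h
  have hcm : ∀ {h : G → F}, LocallyIntegrable h μ → Continuous (c h) := fun h =>
    hcs.continuous_convolution_left _ (φ n).continuous_normed h
  have hsplit : c f - f = c (f - g) + ((c g - g) + (g - f)) := by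
    have : c f = c (f - g) + c g := by
      rw [show c f = c ((f - g) + g) by rw [sub_add_cancel]]
      exact (hce (hfi.sub hgi)).distrib_add (hce hgi)
    rw [this]; abel
  have h1 : eLpNorm (c (f - g)) (ENNReal.ofReal p) (μ.restrict K) ≤ ε / 3 :=
    (eLpNorm_mono_measure _ Measure.restrict_le_self).trans
      ((eLpNorm_normed_convolution_le (φ n) (hfm.sub hg.stronglyMeasurable) hp).trans hfg)
  have h2 : eLpNorm (c g - g) (ENNReal.ofReal p) (μ.restrict K) ≤ ε / 3 := by
    refine (eLpNorm_le_of_ae_bound (C := η) (Eventually.of_forall fun x => ?_)).trans ?_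
    · rw [Pi.sub_apply, ← dist_eq_norm]
      refine (φ n).dist_normed_convolution_le hg.aestronglyMeasurable fun y hy => ?_
      exact (hδg ((Metric.mem_ball.1 hy).trans hn)).le
    · simpa using hηK
  have h3 : eLpNorm (g - f) (ENNReal.ofReal p) (μ.restrict K) ≤ ε / 3 := by
    rw [eLpNorm_sub_comm]
    exact (eLpNorm_mono_measure _ Measure.restrict_le_self).trans hfg
  rw [hsplit]
  have m1 := (hcm (hfi.sub hgi)).aestronglyMeasurable (μ := μ.restrict K)
  have m2 := ((hcm hgi).sub hg).aestronglyMeasurable (μ := μ.restrict K)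
  have m3 := (hg.stronglyMeasurable.sub hfm).aestronglyMeasurable (μ := μ.restrict K)
  calc _ ≤ ε / 3 + (ε / 3 + ε / 3) :=
        (eLpNorm_add_le m1 (m2.add m3) hp1).trans
          (add_le_add h1 ((eLpNorm_add_le m2 m3 hp1).trans (add_le_add h2 h3)))
    _ = ε := by rw [← add_assoc, ENNReal.add_thirds]

end Mollification

/-! ### Gradients and regularization of supersolutions -/

section Gradient

variable {G : Type*} [NormedAddCommGroup G] [InnerProductSpace ℝ G] [CompleteSpace G]

theorem norm_gradient (f : G → ℝ) (x : G) : ‖∇ f x‖ = ‖fderiv ℝ f x‖ := by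
  simp [gradient]

theorem inner_gradient (f : G → ℝ) (x e : G) : ⟪∇ f x, e⟫ = fderiv ℝ f x e := by
  simp [gradient, InnerProductSpace.toDual_symm_apply]

theorem ContDiff.continuous_gradient {f : G → ℝ} {n : ℕ∞ω} (hf : ContDiff ℝ n f) (hn : 1 ≤ n) :
    Continuous (∇ f) :=
  (InnerProductSpace.toDual ℝ G).symm.continuous.comp (hf.continuous_fderiv (by
    intro h; simp [h] at hn))

theorem gradient_eq_zero_of_notMem_tsupport {f : G → ℝ} {x : G} (hx : x ∉ tsupport f) :
    ∇ f x = 0 := by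
  have : fderiv ℝ f x = 0 := by
    by_contra h
    exact hx (support_fderiv_subset ℝ h)
  simp [gradient, this]

theorem gradient_comp_const_sub (f : G → ℝ) (x y : G) :
    ∇ (fun z => f (x - z)) y = - ∇ f (x - y) := by
  have : fderiv ℝ (fun z => f (x - z)) y = - fderiv ℝ f (x - y) := by
    have h1 : (fun z => f (x - z)) = (fun t => f (x + t)) ∘ (ContinuousLinearEquiv.neg ℝ : G ≃L[ℝ] G) := by
      funext z; simp [sub_eq_add_neg]
    rw [h1, ContinuousLinearEquiv.comp_right_fderiv, fderiv_comp_add_left]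
    ext e; simp [sub_eq_add_neg]
  refine ext_inner_right ℝ fun e => ?_
  rw [inner_gradient, this, inner_neg_left, inner_gradient]; rfl

end Gradient

/-- The derivative falls on the kernel, and `y ↦ Φ (x - y)` is a legitimate test function because
its support lies in the ball around `x`. Since only that ball matters, `f` and `F` need to agree
with `u` and `Du` only on `K` and may be extended arbitrarily outside, provided `f` remains locally
integrable. -/
theorem HasSobolevGradient.gradient_convolution {N : ℕ} {Ω K : Set (EuclideanSpace ℝ (Fin N))}
    {p : ℝ} {u : EuclideanSpace ℝ (Fin N) → ℝ}
    {Du : EuclideanSpace ℝ (Fin N) → EuclideanSpace ℝ (Fin N)} (h : HasSobolevGradient Ω p u Du)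
    (hKΩ : K ⊆ Ω) {f : EuclideanSpace ℝ (Fin N) → ℝ}
    {F : EuclideanSpace ℝ (Fin N) → EuclideanSpace ℝ (Fin N)} (hf : LocallyIntegrable f)
    (hfu : f =ᵐ[volume.restrict K] u)
    (hFu : F =ᵐ[volume.restrict K] Du)
    (φ : ContDiffBump (0 : EuclideanSpace ℝ (Fin N))) {x : EuclideanSpace ℝ (Fin N)}
    (hx : Metric.closedBall x φ.rOut ⊆ K) :
    ∇ (φ.normed volume ⋆[ContinuousLinearMap.lsmul ℝ ℝ, volume] f) x =
      (φ.normed volume ⋆[ContinuousLinearMap.lsmul ℝ ℝ, volume] F) x := by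
  set Φ := φ.normed (volume : Measure (EuclideanSpace ℝ (Fin N))) with hΦ
  have hΦd : ContDiff ℝ ∞ Φ := φ.contDiff_normed
  have hcs : HasCompactSupport Φ := φ.hasCompactSupport_normed
  set ψ : EuclideanSpace ℝ (Fin N) → ℝ := fun y => Φ (x - y) with hψ
  have hsupp : tsupport ψ ⊆ Metric.closedBall x φ.rOut := by
    refine closure_minimal (fun y hy => ?_) Metric.isClosed_closedBall
    have : x - y ∈ Function.support Φ := hy
    rw [hΦ, φ.support_normed_eq] at this
    simpa [dist_eq_norm_sub'] using (mem_ball_zero_iff.1 this).le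
  have hψd : ContDiff ℝ ∞ ψ := hΦd.comp (contDiff_const.sub contDiff_id)
  have hψc : HasCompactSupport ψ :=
    HasCompactSupport.of_support_subset_isCompact (isCompact_closedBall x φ.rOut)
      ((subset_tsupport ψ).trans hsupp)
  have hψK : tsupport ψ ⊆ K := hsupp.trans hx
  have hibp := h.integral_by_parts ψ ⟨hψd, hψc, hψK.trans hKΩ⟩
  have e1 : ∫ y in Ω, u y • ∇ ψ y = ∫ y, f y • ∇ ψ y := by
    rw [setIntegral_eq_integral_of_forall_compl_eq_zero (fun y hy => by
        rw [gradient_eq_zero_of_notMem_tsupport fun h => hy (hKΩ (hψK h)), smul_zero]),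
      ← setIntegral_eq_integral_of_forall_compl_eq_zero (s := K) (fun y hy => by
        rw [gradient_eq_zero_of_notMem_tsupport fun h => hy (hψK h), smul_zero]),
      ← setIntegral_eq_integral_of_forall_compl_eq_zero (s := K) (f := fun y => f y • ∇ ψ y)
        (fun y hy => by
          rw [gradient_eq_zero_of_notMem_tsupport fun h => hy (hψK h), smul_zero])]
    exact integral_congr_ae (hfu.mono fun y hy => by simp only [hy])
  have e2 : ∫ y in Ω, ψ y • Du y = ∫ y, ψ y • F y := by
    rw [setIntegral_eq_integral_of_forall_compl_eq_zero (fun y hy => by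
        rw [image_eq_zero_of_notMem_tsupport fun h => hy (hKΩ (hψK h)), zero_smul]),
      ← setIntegral_eq_integral_of_forall_compl_eq_zero (s := K) (fun y hy => by
        rw [image_eq_zero_of_notMem_tsupport fun h => hy (hψK h), zero_smul]),
      ← setIntegral_eq_integral_of_forall_compl_eq_zero (s := K) (f := fun y => ψ y • F y)
        (fun y hy => by
          rw [image_eq_zero_of_notMem_tsupport fun h => hy (hψK h), zero_smul])]
    exact integral_congr_ae (hFu.mono fun y hy => by simp only [hy])
  rw [e1, e2] at hibp
  have hgψ : ∀ y, ∇ ψ y = - ∇ Φ (x - y) := fun y => gradient_comp_const_sub Φ x y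
  rw [convolution_eq_swap]
  change _ = ∫ y, ψ y • F y
  rw [← neg_eq_iff_eq_neg.2 hibp, ← integral_neg]
  have hd := hcs.hasFDerivAt_convolution_left (μ := volume) (ContinuousLinearMap.lsmul ℝ ℝ)
    (hΦd.of_le (by norm_cast)) hf x
  have hint : Integrable fun y => -(f y • ∇ ψ y) := by
    have hc : HasCompactSupport (∇ ψ) := by
      refine HasCompactSupport.intro hψc fun y hy => gradient_eq_zero_of_notMem_tsupport hy
    exact (hf.integrable_smul_right_of_hasCompactSupport
      (hψd.continuous_gradient (by norm_cast)) hc).neg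
  have hex : ConvolutionExistsAt (fderiv ℝ Φ) f x
      ((ContinuousLinearMap.lsmul ℝ ℝ).precompL (EuclideanSpace ℝ (Fin N))) volume :=
    (hcs.fderiv ℝ).convolutionExists_left _ (hΦd.continuous_fderiv (by simp)) hf x
  refine ext_inner_right ℝ fun e => ?_
  rw [inner_gradient, hd.fderiv, convolution_eq_swap, ContinuousLinearMap.integral_apply
    hex.integrable_swap, real_inner_comm, ← integral_inner hint]
  refine integral_congr_ae (Eventually.of_forall fun y => ?_)
  simp only [ContinuousLinearMap.precompL_apply, ContinuousLinearMap.lsmul_apply, hgψ, smul_neg,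
    neg_neg, inner_smul_right, smul_eq_mul]
  rw [real_inner_comm, inner_gradient, mul_comm]

/-- Measurable representatives `v`, `V`, `a` on the compact set `K` of a nonnegative supersolution,
its gradient and its flux, with smooth nonnegative functions `w n` approximating it. -/
structure IsRegularizedSupersolution {N : ℕ} (K : Set (EuclideanSpace ℝ (Fin N))) (p C₀ C₁ : ℝ)
    (v : EuclideanSpace ℝ (Fin N) → ℝ)
    (V a : EuclideanSpace ℝ (Fin N) → EuclideanSpace ℝ (Fin N))
    (w : ℕ → EuclideanSpace ℝ (Fin N) → ℝ) : Prop where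
  isCompact : IsCompact K
  measurable_fun : Measurable v
  measurable_grad : Measurable V
  measurable_flux : Measurable a
  nonneg : ∀ x, 0 ≤ v x
  memLp_grad : MemLp V (ENNReal.ofReal p) (volume.restrict K)
  growth : ∀ᵐ x ∂volume.restrict K,
    C₀ * ‖V x‖ ^ p ≤ ⟪a x, V x⟫ ∧ ‖a x‖ ≤ C₁ * ‖V x‖ ^ (p - 1)
  contDiff_approx : ∀ n, ContDiff ℝ ∞ (w n)
  approx_nonneg : ∀ n x, 0 ≤ w n x
  tendsto_approx : ∀ᵐ x ∂volume.restrict K, Tendsto (fun n => w n x) atTop (𝓝 (v x))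
  tendsto_grad_approx : Tendsto (fun n => eLpNorm (fun x => ∇ (w n) x - V x) (ENNReal.ofReal p)
    (volume.restrict K)) atTop (𝓝 0)
  integral_nonneg : ∀ φ : EuclideanSpace ℝ (Fin N) → ℝ, IsTestFunction K φ → (∀ x, 0 ≤ φ x) →
    0 ≤ ∫ x in K, ⟪a x, ∇ φ x⟫

/-- The function and its gradient are cut off outside a compact thickening of `K` in `Ω` and
mollified at scales at most the thickness, so on `K` the cutoff is invisible. Taking the positive
part makes the representative nonnegative everywhere; then so are its mollifications, and
nonlinearities need be controlled only on `[0, ∞)`. -/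
theorem IsSupersolution.exists_isRegularizedSupersolution {N : ℕ}
    {Ω K : Set (EuclideanSpace ℝ (Fin N))} {p C₀ C₁ : ℝ} (hp : 1 ≤ p)
    {u : EuclideanSpace ℝ (Fin N) → ℝ} (hu : IsSupersolution Ω p C₀ C₁ u)
    (hu0 : ∀ᵐ x ∂volume.restrict Ω, 0 ≤ u x) (hΩ : IsOpen Ω) (hK : IsCompact K) (hKΩ : K ⊆ Ω) :
    ∃ v V a w, v =ᵐ[volume.restrict K] u ∧ IsRegularizedSupersolution K p C₀ C₁ v V a w := by
  obtain ⟨A, hA, Du, hDu, hAm, hweak⟩ := hu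
  have hp1 : (1 : ℝ≥0∞) ≤ ENNReal.ofReal p := by simpa using hp
  obtain ⟨δ, hδ, hδΩ⟩ := hK.exists_cthickening_subset_open hΩ hKΩ
  set K' := Metric.cthickening δ K with hK'
  have hK'c : IsCompact K' := hK.cthickening
  have hKK' : K ⊆ K' := Metric.self_subset_cthickening K
  have hK'm : MeasurableSet K' := hK'c.measurableSet
  have hup := hDu.memLpLoc K' hK'c hδΩ
  have hDp := hDu.memLpLoc_grad K' hK'c hδΩ
  have hu0' : ∀ᵐ x ∂volume.restrict K', 0 ≤ u x := ae_restrict_of_ae_restrict_of_subset hδΩ hu0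
  set v : EuclideanSpace ℝ (Fin N) → ℝ :=
    K'.indicator fun x => max (hup.aestronglyMeasurable.mk u x) 0 with hv
  set V : EuclideanSpace ℝ (Fin N) → EuclideanSpace ℝ (Fin N) :=
    K'.indicator (hDp.aestronglyMeasurable.mk Du) with hV
  have hvm : Measurable v :=
    (hup.aestronglyMeasurable.measurable_mk.max measurable_const).indicator hK'm
  have hVm : StronglyMeasurable V := hDp.aestronglyMeasurable.stronglyMeasurable_mk.indicator hK'm
  have hvu : v =ᵐ[volume.restrict K'] u := by
    filter_upwards [hup.aestronglyMeasurable.ae_eq_mk, hu0', ae_restrict_mem hK'm] with x h1 h2 h3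
    rw [hv, indicator_of_mem h3, ← h1, max_eq_left h2]
  have hVu : V =ᵐ[volume.restrict K'] Du := by
    filter_upwards [hDp.aestronglyMeasurable.ae_eq_mk, ae_restrict_mem hK'm] with x h1 h3
    rw [hV, indicator_of_mem h3, ← h1]
  have hv0 : ∀ x, 0 ≤ v x := fun x => indicator_nonneg (fun _ _ => le_max_right _ _) x
  have hvp : MemLp v (ENNReal.ofReal p) volume := by
    have : K'.indicator v = v := by rw [hv, indicator_indicator, inter_self]
    rw [← this, memLp_indicator_iff_restrict hK'm]
    exact (memLp_congr_ae hvu).2 hup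
  have hVp : MemLp V (ENNReal.ofReal p) volume := by
    have : K'.indicator V = V := by rw [hV, indicator_indicator, inter_self]
    rw [← this, memLp_indicator_iff_restrict hK'm]
    exact (memLp_congr_ae hVu).2 hDp
  -- The fixed ratio 2 of outer to inner radius is what a.e. convergence at Lebesgue points
  -- requires.
  set φ : ℕ → ContDiffBump (0 : EuclideanSpace ℝ (Fin N)) := fun n =>
    ⟨δ / (2 * (n + 1)), δ / (n + 1), by positivity, by
      gcongr; nlinarith [(Nat.cast_nonneg n : (0 : ℝ) ≤ n)]⟩ with hφ
  have hφδ : ∀ n, (φ n).rOut ≤ δ := fun n => by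
    have : (1 : ℝ) ≤ n + 1 := by simp
    exact div_le_self hδ.le this
  have hφ0 : Tendsto (fun n => (φ n).rOut) atTop (𝓝 0) := by
    have := (tendsto_one_div_add_atTop_nhds_zero_nat (𝕜 := ℝ)).const_mul δ
    simpa [hφ, div_eq_mul_inv] using this
  have hvl : LocallyIntegrable v := hvp.locallyIntegrable hp1
  have hVl : LocallyIntegrable V := hVp.locallyIntegrable hp1
  refine ⟨v, V, hAm.mk _, fun n => (φ n).normed volume ⋆[ContinuousLinearMap.lsmul ℝ ℝ, volume] v,
    ae_restrict_of_ae_restrict_of_subset hKK' hvu, ?_⟩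
  have hVuK : V =ᵐ[volume.restrict K] Du := ae_restrict_of_ae_restrict_of_subset hKK' hVu
  have hvuK : v =ᵐ[volume.restrict K] u := ae_restrict_of_ae_restrict_of_subset hKK' hvu
  have hAK : hAm.mk _ =ᵐ[volume.restrict K] fun x => A x (u x) (Du x) :=
    ae_restrict_of_ae_restrict_of_subset hKΩ hAm.ae_eq_mk.symm
  refine ⟨hK, hvm, hVm.measurable, hAm.measurable_mk, hv0, hVp.restrict K, ?_, fun n => ?_,
    fun n x => ?_, ?_, ?_, fun ψ hψ hψ0 => ?_⟩
  · filter_upwards [hAK, hVuK, ae_restrict_of_ae_restrict_of_subset hKΩ hA] with x h1 h2 h3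
    rw [h1, h2]
    exact h3 _ _
  · exact (φ n).hasCompactSupport_normed.contDiff_convolution_left _ (φ n).contDiff_normed hvl
  · rw [convolution_lsmul]
    exact integral_nonneg fun t => mul_nonneg ((φ n).nonneg_normed t) (hv0 _)
  · refine ae_restrict_of_ae (ContDiffBump.ae_convolution_tendsto_right_of_locallyIntegrable
      (K := 2) hφ0 (Eventually.of_forall fun n => le_of_eq ?_) hvl)
    simp only [hφ]
    field_simp
  · refine (tendsto_eLpNorm_normed_convolution_sub hφ0 hp hVm hVp
      hK.measure_lt_top.ne).congr fun n => eLpNorm_congr_ae ?_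
    filter_upwards [ae_restrict_mem hK.measurableSet] with x hx
    rw [Pi.sub_apply, hDu.gradient_convolution hδΩ hvl hvu hVu]
    exact (Metric.closedBall_subset_closedBall (hφδ n)).trans
      (Metric.closedBall_subset_cthickening hx δ)
  · have h := hweak ψ ⟨hψ.contDiff, hψ.hasCompactSupport, hψ.tsupport_subset.trans hKΩ⟩ hψ0
    have h0 : ∀ x ∉ K, ⟪A x (u x) (Du x), ∇ ψ x⟫ = 0 := fun x hx => by
      rw [gradient_eq_zero_of_notMem_tsupport fun h => hx (hψ.tsupport_subset h), inner_zero_right]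
    rw [setIntegral_eq_integral_of_forall_compl_eq_zero fun x hx => h0 x fun h => hx (hKΩ h),
      ← setIntegral_eq_integral_of_forall_compl_eq_zero (s := K) h0] at h
    refine h.trans_eq (integral_congr_ae (hAK.mono fun x hx => ?_))
    simp only [hx]

/-! ### Testing the equation with `ζ g(v)` -/

/-- Products of a bounded, a.e. convergent sequence with an `L^p` convergent one converge in
`L^p`. -/
theorem tendsto_eLpNorm_smul_sub_smul {α F : Type*} [MeasurableSpace α] {μ : Measure α}
    [NormedAddCommGroup F] [NormedSpace ℝ F] {p : ℝ} (hp : 1 ≤ p) {b : ℕ → α → ℝ} {b' : α → ℝ}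
    {M : ℝ} (hbm : ∀ n, AEStronglyMeasurable (b n) μ) (hbM : ∀ n, ∀ᵐ x ∂μ, |b n x| ≤ M)
    (hb : ∀ᵐ x ∂μ, Tendsto (fun n => b n x) atTop (𝓝 (b' x))) {g : ℕ → α → F} {g' : α → F}
    (hgm : ∀ n, AEStronglyMeasurable (g n) μ) (hg' : MemLp g' (ENNReal.ofReal p) μ)
    (hg : Tendsto (fun n => eLpNorm (fun x => g n x - g' x) (ENNReal.ofReal p) μ) atTop (𝓝 0)) :
    Tendsto (fun n => eLpNorm (fun x => b n x • g n x - b' x • g' x) (ENNReal.ofReal p) μ)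
      atTop (𝓝 0) := by
  have hp0 : 0 < p := by linarith
  have hp1 : (1 : ℝ≥0∞) ≤ ENNReal.ofReal p := by simpa using hp
  have hb'm : AEStronglyMeasurable b' μ := aestronglyMeasurable_of_tendsto_ae atTop hbm hb
  have hb'M : ∀ᵐ x ∂μ, |b' x| ≤ M := by
    filter_upwards [hb, ae_all_iff.2 hbM] with x h1 h2
    exact le_of_tendsto h1.abs (Eventually.of_forall h2)
  have t1 : Tendsto (fun n => ENNReal.ofReal M *
      eLpNorm (fun x => g n x - g' x) (ENNReal.ofReal p) μ) atTop (𝓝 0) := by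
    simpa using ENNReal.Tendsto.const_mul hg (Or.inr ENNReal.ofReal_ne_top)
  -- Here the `L^p` factor is frozen at its limit, so dominated convergence applies with majorant
  -- `|2 M g'|^p`.
  have t2 : Tendsto (fun n => eLpNorm (fun x => (b n x - b' x) • g' x) (ENNReal.ofReal p) μ)
      atTop (𝓝 0) := by
    have hpne : ENNReal.ofReal p ≠ 0 := by simpa using hp0
    simp_rw [eLpNorm_eq_lintegral_rpow_enorm_toReal hpne ENNReal.ofReal_ne_top,
      ENNReal.toReal_ofReal hp0.le]
    have h0 : Tendsto (fun n => ∫⁻ x, ‖(b n x - b' x) • g' x‖ₑ ^ p ∂μ) atTop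
        (𝓝 (∫⁻ _, 0 ∂μ)) := by
      refine tendsto_lintegral_of_dominated_convergence'
        (fun x => ‖(2 * M) • g' x‖ₑ ^ p) (fun n => ?_) (fun n => ?_) ?_ ?_
      · exact (((hbm n).sub hb'm).smul hg'.1).enorm.pow_const p
      · filter_upwards [hbM n, hb'M] with x h1 h2
        refine ENNReal.rpow_le_rpow ?_ hp0.le
        rw [enorm_le_iff_norm_le, norm_smul, norm_smul]
        gcongr
        rw [Real.norm_eq_abs, Real.norm_eq_abs]
        calc _ ≤ |b n x| + |b' x| := abs_sub _ _
          _ ≤ 2 * M := by linarith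
          _ ≤ _ := le_abs_self _
      · have := (hg'.const_smul (2 * M)).eLpNorm_lt_top
        rw [eLpNorm_lt_top_iff_lintegral_rpow_enorm_lt_top hpne ENNReal.ofReal_ne_top,
          ENNReal.toReal_ofReal hp0.le] at this
        exact this.ne
      · filter_upwards [hb] with x hx
        have h1 : Tendsto (fun n => (b n x - b' x) • g' x) atTop (𝓝 0) := by
          simpa using (hx.sub_const (b' x)).smul_const (g' x)
        simpa [hp0] using h1.enorm.ennrpow_const p
    rw [lintegral_zero] at h0
    simpa [hp0] using h0.ennrpow_const (1 / p)
  refine tendsto_of_tendsto_of_tendsto_of_le_of_le tendsto_const_nhds (by simpa using t1.add t2)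
    (fun _ => bot_le) fun n => ?_
  have : (fun x => b n x • g n x - b' x • g' x) =
      (fun x => b n x • (g n x - g' x)) + fun x => (b n x - b' x) • g' x := by
    funext x; simp [smul_sub, sub_smul]
  rw [this]
  refine (eLpNorm_add_le ((hbm n).smul ((hgm n).sub hg'.1)) (((hbm n).sub hb'm).smul hg'.1)
    hp1).trans ?_
  refine add_le_add (eLpNorm_le_mul_eLpNorm_of_ae_le_mul ?_ _) le_rfl
  filter_upwards [hbM n] with x hx
  change ‖b n x • (g n x - g' x)‖ ≤ _
  rw [norm_smul]
  gcongr
  exact hx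

theorem ContDiffAt.continuousAt_deriv_real {g : ℝ → ℝ} {s : ℝ} (hg : ContDiffAt ℝ ∞ g s) :
    ContinuousAt (deriv g) s := by
  have h := (hg.fderiv_right (m := 0) (by norm_cast)).continuousAt
  exact h.clm_apply continuousAt_const

section Gradient

variable {G : Type*} [NormedAddCommGroup G] [InnerProductSpace ℝ G] [CompleteSpace G]

theorem gradient_mul_comp {ζ f : G → ℝ} {g : ℝ → ℝ} {x : G} (hζ : DifferentiableAt ℝ ζ x)
    (hf : DifferentiableAt ℝ f x) (hg : DifferentiableAt ℝ g (f x)) :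
    ∇ (fun y => ζ y * g (f y)) x = g (f x) • ∇ ζ x + (ζ x * deriv g (f x)) • ∇ f x := by
  have h1 := hζ.hasFDerivAt.mul (hg.hasDerivAt.comp_hasFDerivAt x hf.hasFDerivAt)
  have h2 : fderiv ℝ (fun y => ζ y * g (f y)) x = _ := h1.fderiv
  refine ext_inner_right ℝ fun e => ?_
  rw [inner_gradient, h2, inner_add_left, real_inner_smul_left, real_inner_smul_left,
    inner_gradient, inner_gradient]
  simp
  ring

end Gradient

namespace IsRegularizedSupersolution

variable {N : ℕ} {K : Set (EuclideanSpace ℝ (Fin N))} {p C₀ C₁ : ℝ}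
  {v : EuclideanSpace ℝ (Fin N) → ℝ} {V a : EuclideanSpace ℝ (Fin N) → EuclideanSpace ℝ (Fin N)}
  {w : ℕ → EuclideanSpace ℝ (Fin N) → ℝ}

/-- The chain rule in the limit, for products `ζ g(v)`. -/
theorem tendsto_gradient_mul_comp (h : IsRegularizedSupersolution K p C₀ C₁ v V a w) (hp : 1 ≤ p)
    {g : ℝ → ℝ} {M : ℝ} (hg : ∀ s, 0 ≤ s → ContDiffAt ℝ ∞ g s) (hgM : ∀ s, 0 ≤ s → |g s| ≤ M)
    (hgM' : ∀ s, 0 ≤ s → |deriv g s| ≤ M) {ζ : EuclideanSpace ℝ (Fin N) → ℝ}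
    (hζ : ContDiff ℝ ∞ ζ) :
    Tendsto (fun n => eLpNorm (fun x => ∇ (fun y => ζ y * g (w n y)) x -
      (g (v x) • ∇ ζ x + (ζ x * deriv g (v x)) • V x)) (ENNReal.ofReal p) (volume.restrict K))
      atTop (𝓝 0) := by
  have hp1 : (1 : ℝ≥0∞) ≤ ENNReal.ofReal p := by simpa using hp
  have hM : 0 ≤ M := (abs_nonneg _).trans (hgM 0 le_rfl)
  have hKm := h.isCompact.measurableSet
  have : IsFiniteMeasure (volume.restrict K) :=
    ⟨by simpa using h.isCompact.measure_lt_top⟩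
  have hgrad : Continuous (∇ ζ) := hζ.continuous_gradient (by norm_cast)
  have hgc : ∀ s, 0 ≤ s → ContinuousAt g s := fun s hs => (hg s hs).continuousAt
  have hgc' : ∀ s, 0 ≤ s → ContinuousAt (deriv g) s := fun s hs =>
    (hg s hs).continuousAt_deriv_real
  have hw : ∀ n, Continuous (w n) := fun n => (h.contDiff_approx n).continuous
  have c1 : ∀ n, Continuous fun x => g (w n x) := fun n => continuous_iff_continuousAt.2 fun x =>
    ContinuousAt.comp (f := w n) (hgc _ (h.approx_nonneg n x)) (hw n).continuousAt
  have c2 : ∀ n, Continuous fun x => ζ x * deriv g (w n x) := fun n =>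
    hζ.continuous.mul (continuous_iff_continuousAt.2 fun x =>
      ContinuousAt.comp (f := w n) (hgc' _ (h.approx_nonneg n x)) (hw n).continuousAt)
  obtain ⟨B, hB⟩ := h.isCompact.exists_bound_of_continuousOn hζ.continuous.continuousOn
  obtain ⟨B', hB'⟩ := h.isCompact.exists_bound_of_continuousOn hgrad.continuousOn
  have mgrad : MemLp (∇ ζ) (ENNReal.ofReal p) (volume.restrict K) :=
    MemLp.of_bound hgrad.aestronglyMeasurable B' ((ae_restrict_mem hKm).mono fun x hx => hB' x hx)
  have l1 := tendsto_eLpNorm_smul_sub_smul (μ := volume.restrict K) hp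
    (b := fun n x => g (w n x)) (b' := fun x => g (v x)) (g := fun _ => ∇ ζ) (g' := ∇ ζ)
    (fun n => (c1 n).aestronglyMeasurable)
    (fun n => Eventually.of_forall fun x => hgM _ (h.approx_nonneg n x))
    (h.tendsto_approx.mono fun x hx => (hgc _ (h.nonneg x)).tendsto.comp hx)
    (fun _ => hgrad.aestronglyMeasurable) mgrad (by simp)
  have l2 := tendsto_eLpNorm_smul_sub_smul (μ := volume.restrict K) hp (M := B * M)
    (b := fun n x => ζ x * deriv g (w n x)) (b' := fun x => ζ x * deriv g (v x))
    (g := fun n => ∇ (w n)) (g' := V)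
    (fun n => (c2 n).aestronglyMeasurable)
    (fun n => (ae_restrict_mem hKm).mono fun x hx => by
      have h1 := hB x hx
      rw [abs_mul]
      exact mul_le_mul h1 (hgM' _ (h.approx_nonneg n x)) (abs_nonneg _) ((norm_nonneg _).trans h1))
    (h.tendsto_approx.mono fun x hx => ((hgc' _ (h.nonneg x)).tendsto.comp hx).const_mul _)
    (fun n => ((h.contDiff_approx n).continuous_gradient (by norm_cast)).aestronglyMeasurable)
    h.memLp_grad h.tendsto_grad_approx
  have m1 : AEStronglyMeasurable (fun x => g (v x)) (volume.restrict K) :=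
    aestronglyMeasurable_of_tendsto_ae atTop (fun n => (c1 n).aestronglyMeasurable)
      (h.tendsto_approx.mono fun x hx => (hgc _ (h.nonneg x)).tendsto.comp hx)
  have m2 : AEStronglyMeasurable (fun x => ζ x * deriv g (v x)) (volume.restrict K) :=
    (hζ.continuous.measurable.mul
      ((measurable_deriv g).comp h.measurable_fun)).aestronglyMeasurable
  refine tendsto_of_tendsto_of_tendsto_of_le_of_le tendsto_const_nhds (by simpa using l1.add l2)
    (fun _ => bot_le) fun n => ?_
  have e : (fun x => ∇ (fun y => ζ y * g (w n y)) x -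
      (g (v x) • ∇ ζ x + (ζ x * deriv g (v x)) • V x)) =
      (fun x => g (w n x) • ∇ ζ x - g (v x) • ∇ ζ x) +
      fun x => (ζ x * deriv g (w n x)) • ∇ (w n) x - (ζ x * deriv g (v x)) • V x := by
    funext x
    rw [gradient_mul_comp (hζ.differentiable (by simp) x)
      ((h.contDiff_approx n).differentiable (by simp) x)
      ((hg _ (h.approx_nonneg n x)).differentiableAt (by simp)), Pi.add_apply]
    abel
  rw [e]
  refine eLpNorm_add_le ?_ ?_ hp1
  · exact (((c1 n).aestronglyMeasurable).smul hgrad.aestronglyMeasurable).sub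
      (m1.smul hgrad.aestronglyMeasurable)
  · exact (((c2 n).aestronglyMeasurable).smul
      ((h.contDiff_approx n).continuous_gradient (by norm_cast)).aestronglyMeasurable).sub
      (m2.smul h.memLp_grad.1)

theorem memLp_flux (h : IsRegularizedSupersolution K p C₀ C₁ v V a w) (hp : 1 < p) :
    MemLp a (ENNReal.ofReal p.conjExponent) (volume.restrict K) := by
  have hp0 : 0 < p - 1 := by linarith
  have h1 := h.memLp_grad.norm_rpow_div (ENNReal.ofReal (p - 1))
  rw [ENNReal.toReal_ofReal hp0.le, ← ENNReal.ofReal_div_of_pos hp0] at h1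
  refine h1.of_le_mul (c := C₁) h.measurable_flux.aestronglyMeasurable ?_
  filter_upwards [h.growth] with x hx
  rw [Real.norm_of_nonneg (by positivity)]
  exact hx.2

theorem integrable_inner_flux (h : IsRegularizedSupersolution K p C₀ C₁ v V a w) (hp : 1 < p)
    {X : EuclideanSpace ℝ (Fin N) → EuclideanSpace ℝ (Fin N)}
    (hX : MemLp X (ENNReal.ofReal p) (volume.restrict K)) :
    Integrable (fun x => ⟪a x, X x⟫) (volume.restrict K) := by
  have := (Real.HolderConjugate.conjExponent hp).symm.ennrealOfReal
  refine ((h.memLp_flux hp).norm.integrable_mul hX.norm).mono'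
    (h.measurable_flux.aestronglyMeasurable.inner hX.1) (Eventually.of_forall fun x => ?_)
  simpa using norm_inner_le_norm (𝕜 := ℝ) (a x) (X x)

/-- The weak inequality tested with `ζ g(v)`. -/
theorem integral_inner_mul_comp_nonneg (h : IsRegularizedSupersolution K p C₀ C₁ v V a w)
    (hp : 1 < p) {g : ℝ → ℝ} {M : ℝ} (hg : ∀ s, 0 ≤ s → ContDiffAt ℝ ∞ g s)
    (hg0 : ∀ s, 0 ≤ s → 0 ≤ g s) (hgM : ∀ s, 0 ≤ s → |g s| ≤ M)
    (hgM' : ∀ s, 0 ≤ s → |deriv g s| ≤ M) {ζ : EuclideanSpace ℝ (Fin N) → ℝ}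
    (hζ : IsTestFunction K ζ) (hζ0 : ∀ x, 0 ≤ ζ x) :
    0 ≤ ∫ x in K, ⟪a x, g (v x) • ∇ ζ x + (ζ x * deriv g (v x)) • V x⟫ ∧
    MemLp (fun x => g (v x) • ∇ ζ x + (ζ x * deriv g (v x)) • V x) (ENNReal.ofReal p)
      (volume.restrict K) := by
  have hp1 : (1 : ℝ≥0∞) ≤ ENNReal.ofReal p := by simpa using hp.le
  have : IsFiniteMeasure (volume.restrict K) :=
    ⟨by simpa using h.isCompact.measure_lt_top⟩
  set X : EuclideanSpace ℝ (Fin N) → EuclideanSpace ℝ (Fin N) :=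
    fun x => g (v x) • ∇ ζ x + (ζ x * deriv g (v x)) • V x with hX
  set φ : ℕ → EuclideanSpace ℝ (Fin N) → ℝ := fun n y => ζ y * g (w n y) with hφ
  have hlim : Tendsto (fun n => eLpNorm (fun x => ∇ (φ n) x - X x) (ENNReal.ofReal p)
      (volume.restrict K)) atTop (𝓝 0) :=
    h.tendsto_gradient_mul_comp hp.le hg hgM hgM' hζ.contDiff
  have hφt : ∀ n, IsTestFunction K (φ n) := fun n => by
    refine ⟨?_, hζ.hasCompactSupport.mul_right, (tsupport_mul_subset_left).trans
      hζ.tsupport_subset⟩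
    refine hζ.contDiff.mul (contDiff_iff_contDiffAt.2 fun x => ?_)
    exact (hg _ (h.approx_nonneg n x)).comp x (h.contDiff_approx n).contDiffAt
  have hφL : ∀ n, MemLp (∇ (φ n)) (ENNReal.ofReal p) (volume.restrict K) := fun n => by
    have hc := (hφt n).contDiff.continuous_gradient (by norm_cast)
    obtain ⟨B, hB⟩ := h.isCompact.exists_bound_of_continuousOn hc.continuousOn
    exact MemLp.of_bound hc.aestronglyMeasurable B
      ((ae_restrict_mem h.isCompact.measurableSet).mono fun x hx => hB x hx)
  have hgv : AEStronglyMeasurable (fun x => g (v x)) (volume.restrict K) := by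
    refine aestronglyMeasurable_of_tendsto_ae atTop (f := fun n x => g (w n x)) (fun n => ?_)
      (h.tendsto_approx.mono fun x hx => ((hg _ (h.nonneg x)).continuousAt).tendsto.comp hx)
    exact (continuous_iff_continuousAt.2 fun x =>
      ContinuousAt.comp (f := w n) (hg _ (h.approx_nonneg n x)).continuousAt
        (h.contDiff_approx n).continuous.continuousAt).aestronglyMeasurable
  have hXm : AEStronglyMeasurable X (volume.restrict K) :=
    (hgv.smul (hζ.contDiff.continuous_gradient (by norm_cast)).aestronglyMeasurable).add
      (((hζ.contDiff.continuous.measurable.mul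
        ((measurable_deriv g).comp h.measurable_fun)).aestronglyMeasurable).smul h.memLp_grad.1)
  have hXL : MemLp X (ENNReal.ofReal p) (volume.restrict K) := by
    obtain ⟨n, hn⟩ := (hlim.eventually (gt_mem_nhds (zero_lt_one' ℝ≥0∞))).exists
    have h1 : MemLp (fun x => ∇ (φ n) x - X x) (ENNReal.ofReal p) (volume.restrict K) :=
      ⟨(hφL n).1.sub hXm, hn.trans ENNReal.one_lt_top⟩
    have : X = fun x => ∇ (φ n) x - (∇ (φ n) x - X x) := by funext x; abel
    rw [this]
    exact (hφL n).sub h1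
  refine ⟨?_, hXL⟩
  have hconj := (Real.HolderConjugate.conjExponent hp).symm.ennrealOfReal
  -- By the growth condition the flux lies in the conjugate Lebesgue space, so Hölder's inequality
  -- turns `L^p` convergence of the gradients into convergence of the integrals.
  have ht : Tendsto (fun n => ∫ x in K, ⟪a x, ∇ (φ n) x⟫) atTop (𝓝 (∫ x in K, ⟪a x, X x⟫)) := by
    refine tendsto_integral_of_L1' _ (h.integrable_inner_flux hp hXL).1
      (Eventually.of_forall fun n => h.integrable_inner_flux hp (hφL n)) ?_
    have t1 := ENNReal.Tendsto.const_mul hlim (a := eLpNorm (fun x => ‖a x‖)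
      (ENNReal.ofReal p.conjExponent) (volume.restrict K))
      (Or.inr (h.memLp_flux hp).norm.eLpNorm_ne_top)
    rw [mul_zero] at t1
    refine tendsto_of_tendsto_of_tendsto_of_le_of_le tendsto_const_nhds t1 (fun _ => bot_le)
      fun n => ?_
    refine le_trans ?_ (eLpNorm_smul_le_mul_eLpNorm (r := 1) ((hφL n).1.sub hXm)
      (h.memLp_flux hp).norm.1)
    refine eLpNorm_mono fun x => ?_
    rw [Pi.sub_apply, ← inner_sub_right, Pi.smul_apply', norm_smul, norm_norm]
    exact norm_inner_le_norm _ _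
  exact ge_of_tendsto' ht fun n => h.integral_nonneg _ (hφt n) fun x =>
    mul_nonneg (hζ0 x) (hg0 _ (h.approx_nonneg n x))

end IsRegularizedSupersolution

/-! ### Energy estimate -/

/-- A form of Young's inequality: the two terms on the right balance at `X = (2A/c)^p`, and each
dominates on one side of this threshold. The factor `c / 2` allows absorption into a term `c * X`.
-/
theorem mul_rpow_le_add_of_nonneg {p c A X : ℝ} (hp : 1 < p) (hc : 0 < c) (hA : 0 ≤ A)
    (hX : 0 ≤ X) :
    A * X ^ ((p - 1) / p) ≤ c / 2 * X + A * (2 * A / c) ^ (p - 1) := by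
  have hp0 : 0 < p := by linarith
  have hq : 0 ≤ 2 * A / c := by positivity
  have he : 0 ≤ (p - 1) / p := div_nonneg (by linarith) hp0.le
  rcases le_total X ((2 * A / c) ^ p) with h | h
  · have h1 : X ^ ((p - 1) / p) ≤ (2 * A / c) ^ (p - 1) := by
      refine (Real.rpow_le_rpow hX h he).trans (le_of_eq ?_)
      rw [← Real.rpow_mul hq]
      congr 1
      field_simp
    have h2 := mul_le_mul_of_nonneg_left h1 hA
    have : 0 ≤ c / 2 * X := by positivity
    linarith
  · have h1 : 2 * A / c ≤ X ^ (1 / p) := by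
      have := Real.rpow_le_rpow (by positivity) h (by positivity : 0 ≤ 1 / p)
      rwa [← Real.rpow_mul hq, mul_one_div_cancel hp0.ne', Real.rpow_one] at this
    have h2 : X ^ (1 / p) * X ^ ((p - 1) / p) = X := by
      rw [← Real.rpow_add_of_nonneg hX (by positivity) he]
      rw [show 1 / p + (p - 1) / p = 1 by field_simp; ring, Real.rpow_one]
    have h3 : A ≤ c / 2 * X ^ (1 / p) := by
      rw [div_le_iff₀ hc] at h1; linarith
    have h4 : A * X ^ ((p - 1) / p) ≤ c / 2 * X := by
      calc _ ≤ c / 2 * X ^ (1 / p) * X ^ ((p - 1) / p) := by gcongr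
        _ = _ := by rw [mul_assoc, h2]
    have : 0 ≤ A * (2 * A / c) ^ (p - 1) := by positivity
    linarith

/-- The energy estimate for a supersolution, for a nonincreasing `g` and a cutoff `ζ`. -/
theorem IsRegularizedSupersolution.lintegral_energy_le {N : ℕ}
    {K : Set (EuclideanSpace ℝ (Fin N))} {p C₀ C₁ : ℝ} {v : EuclideanSpace ℝ (Fin N) → ℝ}
    {V a : EuclideanSpace ℝ (Fin N) → EuclideanSpace ℝ (Fin N)}
    {w : ℕ → EuclideanSpace ℝ (Fin N) → ℝ} (h : IsRegularizedSupersolution K p C₀ C₁ v V a w)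
    (hp : 1 < p) (hC₀ : 0 < C₀) (hC₁ : 0 < C₁) {g : ℝ → ℝ} {B M L : ℝ}
    (hg : ∀ s, 0 ≤ s → ContDiffAt ℝ ∞ g s) (hg0 : ∀ s, 0 ≤ s → 0 ≤ g s)
    (hgB : ∀ s, 0 ≤ s → |g s| ≤ B) (hgB' : ∀ s, 0 ≤ s → |deriv g s| ≤ B)
    (hg' : ∀ s, 0 ≤ s → deriv g s ≤ 0) (hM : 0 ≤ M)
    (hgM : ∀ s, 0 ≤ s → g s ≤ M * (- deriv g s) ^ ((p - 1) / p))
    {ζ : EuclideanSpace ℝ (Fin N) → ℝ} (hζ : IsTestFunction K ζ) (hζ0 : ∀ x, 0 ≤ ζ x)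
    (hL : 0 ≤ L) (hζL : ∀ x, ‖∇ ζ x‖ ≤ L * ζ x ^ ((p - 1) / p))
    {S : Set (EuclideanSpace ℝ (Fin N))} (hS : MeasurableSet S)
    (hSg : ∀ x, x ∉ S → ζ x = 0 ∨ g (v x) = 0) :
    ∫⁻ x in K, ENNReal.ofReal (ζ x * (- deriv g (v x)) * ‖V x‖ ^ p) ≤
      ENNReal.ofReal ((2 * (C₁ * L * M) / C₀) ^ p) * volume.restrict K S := by
  have hp0 : 0 < p := by linarith
  have he : 0 < (p - 1) / p := div_pos (by linarith) hp0
  have : IsFiniteMeasure (volume.restrict K) :=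
    ⟨by simpa using h.isCompact.measure_lt_top⟩
  obtain ⟨hint, hXL⟩ := h.integral_inner_mul_comp_nonneg hp hg hg0 hgB hgB' hζ hζ0
  have hXi := h.integrable_inner_flux hp hXL
  set A := C₁ * L * M with hA
  have hA0 : 0 ≤ A := by positivity
  set c := A * (2 * A / C₀) ^ (p - 1) with hc
  have hSi : Integrable (S.indicator fun _ => c) (volume.restrict K) :=
    (integrable_const c).indicator hS
  set X : EuclideanSpace ℝ (Fin N) → EuclideanSpace ℝ (Fin N) :=
    fun x => g (v x) • ∇ ζ x + (ζ x * deriv g (v x)) • V x with hX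
  have hpt : ∀ᵐ x ∂volume.restrict K, ζ x * (- deriv g (v x)) * ‖V x‖ ^ p ≤
      2 / C₀ * (S.indicator (fun _ => c) x - ⟪a x, X x⟫) := by
    filter_upwards [h.growth] with x hx
    have hv := h.nonneg x
    set d := - deriv g (v x) with hd
    have hd0 : 0 ≤ d := by have := hg' _ hv; linarith
    set I := ζ x * d * ‖V x‖ ^ p with hI
    have hI0 : 0 ≤ I := by have := hζ0 x; positivity
    have hIp : I ^ ((p - 1) / p) = ζ x ^ ((p - 1) / p) * d ^ ((p - 1) / p) * ‖V x‖ ^ (p - 1) := by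
      rw [hI, Real.mul_rpow (mul_nonneg (hζ0 x) hd0) (by positivity), Real.mul_rpow (hζ0 x) hd0,
        ← Real.rpow_mul (norm_nonneg _)]
      congr 2
      field_simp
    have hX1 : ⟪a x, X x⟫ = g (v x) * ⟪a x, ∇ ζ x⟫ - ζ x * d * ⟪a x, V x⟫ := by
      rw [hX, inner_add_right, inner_smul_right, inner_smul_right, hd]; ring
    have h2 : ζ x * d * ⟪a x, V x⟫ ≥ C₀ * I := by
      rw [hI]
      have := mul_le_mul_of_nonneg_left hx.1 (mul_nonneg (hζ0 x) hd0)
      linarith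
    -- The bounds on `g` and `∇ ζ` carry the power `(p-1)/p` so that the cross term is at most `A *
    -- I ^ ((p-1)/p)`; Young then lets half of the coercive term absorb it. Off `S` the cross term
    -- vanishes: where `ζ = 0`, the bound on `∇ ζ` forces `∇ ζ = 0`.
    have h1 : g (v x) * ⟪a x, ∇ ζ x⟫ ≤ C₀ / 2 * I + S.indicator (fun _ => c) x := by
      by_cases hxS : x ∈ S
      · rw [indicator_of_mem hxS]
        refine le_trans ?_ (mul_rpow_le_add_of_nonneg hp hC₀ hA0 hI0)
        have h3 : ⟪a x, ∇ ζ x⟫ ≤ (C₁ * ‖V x‖ ^ (p - 1)) * (L * ζ x ^ ((p - 1) / p)) :=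
          (real_inner_le_norm _ _).trans
            (mul_le_mul hx.2 (hζL x) (norm_nonneg _) (by positivity))
        have h4 : 0 ≤ (C₁ * ‖V x‖ ^ (p - 1)) * (L * ζ x ^ ((p - 1) / p)) := by
          have := hζ0 x; positivity
        calc _ ≤ g (v x) * ((C₁ * ‖V x‖ ^ (p - 1)) * (L * ζ x ^ ((p - 1) / p))) :=
              mul_le_mul_of_nonneg_left h3 (hg0 _ hv)
          _ ≤ (M * d ^ ((p - 1) / p)) * ((C₁ * ‖V x‖ ^ (p - 1)) * (L * ζ x ^ ((p - 1) / p))) :=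
              mul_le_mul_of_nonneg_right (hgM _ hv) h4
          _ = _ := by rw [hIp, hA]; ring
      · rw [indicator_of_notMem hxS]
        have : g (v x) * ⟪a x, ∇ ζ x⟫ = 0 := by
          rcases hSg x hxS with h0 | h0
          · have h5 := hζL x
            rw [h0, Real.zero_rpow he.ne', mul_zero] at h5
            rw [norm_le_zero_iff.1 h5, inner_zero_right, mul_zero]
          · rw [h0, zero_mul]
        rw [this]; positivity
    have h6 : C₀ / 2 * I ≤ S.indicator (fun _ => c) x - ⟪a x, X x⟫ := by rw [hX1]; linarith
    calc I = 2 / C₀ * (C₀ / 2 * I) := by field_simp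
      _ ≤ _ := by gcongr
  calc _ ≤ ∫⁻ x in K, ENNReal.ofReal (2 / C₀ * (S.indicator (fun _ => c) x - ⟪a x, X x⟫)) :=
        lintegral_mono_ae (hpt.mono fun x hx => ENNReal.ofReal_le_ofReal hx)
    _ = ENNReal.ofReal (∫ x in K, 2 / C₀ * (S.indicator (fun _ => c) x - ⟪a x, X x⟫)) := by
        refine (ofReal_integral_eq_lintegral_ofReal ((hSi.sub hXi).const_mul _) ?_).symm
        filter_upwards [hpt] with x hx
        refine le_trans ?_ hx
        have h1 := hg' _ (h.nonneg x)
        have h2 := hζ0 x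
        have h3 : 0 ≤ -deriv g (v x) := by linarith
        positivity
    _ ≤ ENNReal.ofReal ((2 * A / C₀) ^ p * (volume.restrict K).real S) := by
        refine ENNReal.ofReal_le_ofReal ?_
        rw [integral_const_mul, integral_sub hSi hXi, integral_indicator_const _ hS, smul_eq_mul]
        have e : (2 * A / C₀) ^ p = 2 / C₀ * c := by
          have hq : 0 ≤ 2 * A / C₀ := by positivity
          rw [hc, show p = (p - 1) + 1 by ring, Real.rpow_add_one' hq (by linarith)]
          rw [show p - 1 + 1 - 1 = p - 1 by ring]
          ring
        rw [e]
        have : 0 < 2 / C₀ := by positivity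
        nlinarith
    _ = _ := by
        rw [ENNReal.ofReal_mul (by positivity), Measure.real, ENNReal.ofReal_toReal
          (measure_ne_top _ _)]

/-! ### Cubes and cutoff functions -/

theorem exists_lipschitzWith_smoothTransition : ∃ C, LipschitzWith C Real.smoothTransition := by
  have hd : ContDiff ℝ ∞ Real.smoothTransition := Real.smoothTransition.contDiff
  have hc : Continuous (deriv Real.smoothTransition) := hd.continuous_deriv (by norm_cast)
  obtain ⟨C, hC⟩ := (isCompact_Icc (a := (0 : ℝ)) (b := 1)).exists_bound_of_continuousOn
    hc.continuousOn
  refine ⟨C.toNNReal, lipschitzWith_of_nnnorm_deriv_le (hd.differentiable (by simp)) fun x => ?_⟩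
  rw [← NNReal.coe_le_coe, coe_nnnorm, Real.coe_toNNReal']
  by_cases hx : x ∈ Icc (0 : ℝ) 1
  · exact (hC x hx).trans (le_max_left _ _)
  · have h0 : deriv Real.smoothTransition x = 0 := by
      rw [mem_Icc, not_and_or, not_le, not_le] at hx
      rcases hx with hx | hx
      · have : Real.smoothTransition =ᶠ[𝓝 x] fun _ => 0 := by
          filter_upwards [gt_mem_nhds hx] with y hy
          exact Real.smoothTransition.zero_of_nonpos hy.le
        rw [this.deriv_eq, deriv_const]
      · have : Real.smoothTransition =ᶠ[𝓝 x] fun _ => 1 := by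
          filter_upwards [lt_mem_nhds hx] with y hy
          exact Real.smoothTransition.one_of_one_le hy.le
        rw [this.deriv_eq, deriv_const]
    rw [h0, norm_zero]
    exact le_max_right _ _

/-- The closed cube of side `r` centred at the origin. -/
def closedCube (N : ℕ) (r : ℝ) : Set (EuclideanSpace ℝ (Fin N)) :=
  {x | ∀ i, |x i| ≤ r / 2}

theorem isClosed_closedCube (N : ℕ) (r : ℝ) : IsClosed (closedCube N r) := by
  simp only [closedCube, ofPred_forall]
  exact isClosed_iInter fun i => isClosed_le (by fun_prop) continuous_const

theorem isCompact_closedCube (N : ℕ) (r : ℝ) : IsCompact (closedCube N r) := by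
  refine Metric.isCompact_of_isClosed_isBounded (isClosed_closedCube N r) ?_
  have h : Bornology.IsBounded (Set.pi univ fun _ : Fin N => Icc (-(r / 2)) (r / 2)) :=
    (isCompact_univ_pi fun _ => isCompact_Icc).isBounded
  have h2 := (PiLp.antilipschitzWith_ofLp 2 (fun _ : Fin N => ℝ)).isBounded_preimage h
  refine h2.subset fun x hx => ?_
  exact fun i _ => abs_le.1 (hx i)

theorem isOpen_cube (N : ℕ) (r : ℝ) : IsOpen (cube N r) := by
  simp only [cube, ofPred_forall]
  exact isOpen_iInter_of_finite fun i => isOpen_lt (by fun_prop) continuous_const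

theorem cube_subset_closedCube (N : ℕ) {r s : ℝ} (h : r ≤ s) : cube N r ⊆ closedCube N s :=
  fun x hx i => (hx i).le.trans (by linarith)

theorem cube_subset_cube (N : ℕ) {r s : ℝ} (h : r ≤ s) : cube N r ⊆ cube N s :=
  fun x hx i => (hx i).trans_le (by linarith)

theorem closedCube_subset_cube (N : ℕ) {r s : ℝ} (h : r < s) : closedCube N r ⊆ cube N s :=
  fun x hx i => (hx i).trans_lt (by linarith)

theorem closedCube_subset_closedCube (N : ℕ) {r s : ℝ} (h : r ≤ s) :
    closedCube N r ⊆ closedCube N s :=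
  fun x hx i => (hx i).trans (by linarith)

/-- Cutoff functions between concentric cubes, with `|∇ζ|` controlled by a power of `ζ`. -/
theorem exists_cutoff (N : ℕ) {p : ℝ} (hp : 1 ≤ p) : ∃ L : ℝ, 0 < L ∧ ∀ r s : ℝ, r < s →
    ∃ ζ : EuclideanSpace ℝ (Fin N) → ℝ, IsTestFunction (closedCube N s) ζ ∧ (∀ x, 0 ≤ ζ x) ∧
      (∀ x, ζ x ≤ 1) ∧ (∀ x ∈ cube N r, ζ x = 1) ∧
      ∀ x, ‖∇ ζ x‖ ≤ L / (s - r) * ζ x ^ ((p - 1) / p) := by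
  obtain ⟨C, hC⟩ := exists_lipschitzWith_smoothTransition
  set σ := Real.smoothTransition with hσ
  have hσd : ContDiff ℝ ∞ σ := Real.smoothTransition.contDiff
  have hσ0 : ∀ t, 0 ≤ σ t := Real.smoothTransition.nonneg
  have hσ1 : ∀ t, σ t ≤ 1 := Real.smoothTransition.le_one
  -- The cutoff will be an `m`-th power `f ^ m` with `0 ≤ f ≤ 1`: its gradient carries `f ^ (m-1)`,
  -- which is at most `(f ^ m) ^ ((p-1)/p)` because `m ≥ p`.
  set m := ⌈p⌉₊ with hm
  have hmp : p ≤ m := Nat.le_ceil p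
  have hm1 : 1 ≤ m := by
    have : (1 : ℝ) ≤ m := hp.trans hmp
    exact_mod_cast this
  have hp0 : 0 < p := by linarith
  refine ⟨m * (C * (N * (2 * (C * 2)))) + 1, by positivity, fun r s hrs => ?_⟩
  have hd : 0 < s - r := by linarith
  -- `ψ = 1` on the inner cube, where all transitions vanish; one coordinate leaving the outer cube
  -- already contributes 1 to the sum and makes `ψ ≤ 0`. Composing with `σ` once more gives values
  -- in `[0, 1]`.
  set ψ : EuclideanSpace ℝ (Fin N) → ℝ := fun x =>
    1 - ∑ i, (σ ((2 * x i - r) / (s - r)) + σ ((-2 * x i - r) / (s - r))) with hψ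
  have hψd : ContDiff ℝ ∞ ψ := by
    refine contDiff_const.sub (ContDiff.sum fun i _ => ?_)
    refine (hσd.comp ?_).add (hσd.comp ?_) <;> fun_prop
  have hψL : ∀ x y, |ψ x - ψ y| ≤ (N * (2 * (C * 2)) / (s - r)) * ‖x - y‖ := by
    intro x y
    have h1 : ∀ i : Fin N, ∀ e : ℝ, |e| = 2 →
        |σ ((e * x i - r) / (s - r)) - σ ((e * y i - r) / (s - r))| ≤
        C * 2 / (s - r) * ‖x - y‖ := by
      intro i e he
      have h2 := hC.dist_le_mul ((e * x i - r) / (s - r)) ((e * y i - r) / (s - r))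
      rw [Real.dist_eq, Real.dist_eq] at h2
      refine h2.trans ?_
      rw [show (e * x i - r) / (s - r) - (e * y i - r) / (s - r) = e * (x i - y i) / (s - r) by
        ring, abs_div, abs_mul, he, abs_of_pos hd]
      have h3 : |x i - y i| ≤ ‖x - y‖ := by simpa using PiLp.norm_apply_le (x - y) i
      calc C * (2 * |x i - y i| / (s - r)) = C * 2 / (s - r) * |x i - y i| := by ring
        _ ≤ _ := by gcongr
    have h2 : ψ x - ψ y = -∑ i, ((σ ((2 * x i - r) / (s - r)) - σ ((2 * y i - r) / (s - r))) +
        (σ ((-2 * x i - r) / (s - r)) - σ ((-2 * y i - r) / (s - r)))) := by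
      simp only [hψ, Finset.sum_add_distrib, Finset.sum_sub_distrib]; ring
    rw [h2, abs_neg]
    refine (Finset.abs_sum_le_sum_abs _ _).trans ?_
    calc _ ≤ ∑ _i : Fin N, (C * 2 / (s - r) * ‖x - y‖ + C * 2 / (s - r) * ‖x - y‖) :=
          Finset.sum_le_sum fun i _ => (abs_add_le _ _).trans
            (add_le_add (h1 i 2 (by norm_num)) (h1 i (-2) (by norm_num)))
      _ = _ := by simp; ring
  set f : EuclideanSpace ℝ (Fin N) → ℝ := fun x => σ (ψ x) with hf
  have hfd : ContDiff ℝ ∞ f := hσd.comp hψd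
  set L' : ℝ := C * (N * (2 * (C * 2)) / (s - r)) with hL'
  have hfL : LipschitzWith L'.toNNReal f := by
    refine LipschitzWith.of_dist_le_mul fun x y => ?_
    rw [Real.coe_toNNReal _ (by positivity), hL', mul_assoc, dist_eq_norm x y]
    refine (hC.dist_le_mul _ _).trans ?_
    gcongr
    exact hψL x y
  have hf0 : ∀ x, 0 ≤ f x := fun x => hσ0 _
  have hf1 : ∀ x, f x ≤ 1 := fun x => hσ1 _
  have hout : ∀ x, x ∉ closedCube N s → f x = 0 := by
    intro x hx
    simp only [closedCube, mem_ofPred_eq, not_forall, not_le] at hx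
    obtain ⟨i, hi⟩ := hx
    refine Real.smoothTransition.zero_of_nonpos ?_
    have h1 : (1 : ℝ) ≤ σ ((2 * x i - r) / (s - r)) + σ ((-2 * x i - r) / (s - r)) := by
      rcases lt_abs.1 hi with h | h
      · have : σ ((2 * x i - r) / (s - r)) = 1 := Real.smoothTransition.one_of_one_le (by
          rw [le_div_iff₀ hd]; linarith)
        rw [this]; linarith [hσ0 ((-2 * x i - r) / (s - r))]
      · have : σ ((-2 * x i - r) / (s - r)) = 1 := Real.smoothTransition.one_of_one_le (by
          rw [le_div_iff₀ hd]; linarith)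
        rw [this]; linarith [hσ0 ((2 * x i - r) / (s - r))]
    have h2 := Finset.single_le_sum (f := fun i =>
      σ ((2 * x i - r) / (s - r)) + σ ((-2 * x i - r) / (s - r)))
      (fun i _ => add_nonneg (hσ0 _) (hσ0 _)) (Finset.mem_univ i)
    simp only [hψ]
    linarith
  have hin : ∀ x ∈ cube N r, f x = 1 := by
    intro x hx
    have h0 : ψ x = 1 := by
      simp only [hψ]
      rw [Finset.sum_eq_zero, sub_zero]
      intro i _
      have hi := abs_lt.1 (hx i)
      rw [hσ, Real.smoothTransition.zero_of_nonpos, Real.smoothTransition.zero_of_nonpos, add_zero]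
      · exact div_nonpos_of_nonpos_of_nonneg (by linarith) hd.le
      · exact div_nonpos_of_nonpos_of_nonneg (by linarith) hd.le
    rw [hf]
    simp only [h0]
    exact Real.smoothTransition.one
  have hts : tsupport (fun x => f x ^ m) ⊆ closedCube N s := by
    refine closure_minimal (fun x hx => ?_) (isClosed_closedCube N s)
    by_contra h
    exact hx (by simp only [hout x h]; exact zero_pow (by omega))
  refine ⟨fun x => f x ^ m, ⟨hfd.pow m, ?_, hts⟩, fun x => pow_nonneg (hf0 x) m,
    fun x => pow_le_one₀ (hf0 x) (hf1 x), fun x hx => by simp only [hin x hx, one_pow],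
    fun x => ?_⟩
  · exact HasCompactSupport.of_support_subset_isCompact (isCompact_closedCube N s)
      ((subset_tsupport _).trans hts)
  · have h1 : fderiv ℝ (fun x => f x ^ m) x = (m * f x ^ (m - 1)) • fderiv ℝ f x := by
      have := ((hfd.differentiable (by simp) x).hasFDerivAt.pow m).fderiv
      simpa using this
    have h2 : ‖fderiv ℝ f x‖ ≤ L' := by
      have := norm_fderiv_le_of_lipschitz ℝ hfL (x₀ := x)
      rwa [Real.coe_toNNReal _ (by positivity)] at this
    have h3 : f x ^ (m - 1) ≤ (f x ^ m) ^ ((p - 1) / p) := by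
      rw [← Real.rpow_natCast (f x) m, ← Real.rpow_mul (hf0 x), ← Real.rpow_natCast,
        Nat.cast_sub hm1, Nat.cast_one]
      rcases (hf0 x).eq_or_lt with h0 | h0
      · rw [← h0]
        rcases hp.eq_or_lt with rfl | hp1
        · simp [hm]
        · have : (m : ℝ) * ((p - 1) / p) ≠ 0 := by
            have : 0 < p - 1 := by linarith
            positivity
          rw [Real.zero_rpow this, Real.zero_rpow (by linarith)]
      · refine Real.rpow_le_rpow_of_exponent_ge h0 (hf1 x) ?_
        rw [mul_div_assoc', div_le_iff₀ hp0]
        nlinarith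
    rw [norm_gradient, h1, norm_smul, Real.norm_of_nonneg (by have := hf0 x; positivity)]
    calc (m * f x ^ (m - 1)) * ‖fderiv ℝ f x‖ ≤ (m * (f x ^ m) ^ ((p - 1) / p)) * L' := by
          have := hf0 x
          gcongr
      _ = m * (C * (N * (2 * (C * 2)))) / (s - r) * (f x ^ m) ^ ((p - 1) / p) := by
          rw [hL']; ring
      _ ≤ _ := by
          have := hf0 x
          gcongr
          linarith

theorem EuclideanSpace.volume_forall_mem {N : ℕ} {s : Set ℝ} (hs : MeasurableSet s) :
    volume {x : EuclideanSpace ℝ (Fin N) | ∀ i, x i ∈ s} = volume s ^ N := by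
  have h := (EuclideanSpace.volume_preserving_symm_measurableEquiv_toLp (Fin N)).measure_preimage
    (MeasurableSet.univ_pi fun _ : Fin N => hs).nullMeasurableSet
  rw [volume_pi_pi, Finset.prod_const, Finset.card_univ, Fintype.card_fin] at h
  rw [← h]
  congr 1
  ext x
  simp

theorem volume_closedCube (N : ℕ) (r : ℝ) :
    volume (closedCube N r) = ENNReal.ofReal r ^ N := by
  have e : closedCube N r = {x | ∀ i, x i ∈ Icc (-(r / 2)) (r / 2)} := by
    ext x; simp [closedCube, abs_le]
  rw [e, EuclideanSpace.volume_forall_mem measurableSet_Icc, Real.volume_Icc]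
  ring_nf

theorem volume_cube (N : ℕ) (r : ℝ) : volume (cube N r) = ENNReal.ofReal r ^ N := by
  have e : cube N r = {x | ∀ i, x i ∈ Ioo (-(r / 2)) (r / 2)} := by
    ext x; simp [cube, abs_lt]
  rw [e, EuclideanSpace.volume_forall_mem measurableSet_Ioo, Real.volume_Ioo]
  ring_nf

/-! ### Poincaré inequality on convex sets -/

section Poincare

variable {G : Type*} [NormedAddCommGroup G] [NormedSpace ℝ G] [MeasurableSpace G]
  [BorelSpace G] [FiniteDimensional ℝ G]

theorem lintegral_comp_add_smul (μ : Measure G) [μ.IsAddHaarMeasure] {F : G → ℝ≥0∞}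
    (hF : Measurable F) (c : G) {t : ℝ} (ht : t ≠ 0) :
    ∫⁻ y, F (c + t • y) ∂μ = ENNReal.ofReal |(t ^ Module.finrank ℝ G)⁻¹| * ∫⁻ z, F z ∂μ := by
  have h1 : ∫⁻ y, F (c + t • y) ∂μ = ∫⁻ z, F (c + z) ∂(μ.map (t • ·)) :=
    (lintegral_map (hF.comp (measurable_const_add c)) (measurable_const_smul t)).symm
  rw [h1, Measure.map_addHaar_smul μ ht, lintegral_smul_measure, smul_eq_mul,
    lintegral_add_left_eq_self]

/-- A Poincaré inequality in double integral form on convex sets. -/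
theorem lintegral_lintegral_enorm_sub_le (μ : Measure G) [μ.IsAddHaarMeasure] {K : Set G}
    (hK : MeasurableSet K) (hKc : Convex ℝ K) {D : ℝ} (hD : ∀ x ∈ K, ∀ y ∈ K, ‖y - x‖ ≤ D)
    {f : G → ℝ} (hf : ContDiff ℝ 1 f) :
    ∫⁻ x in K, ∫⁻ y in K, ‖f x - f y‖ₑ ∂μ ∂μ ≤
      ENNReal.ofReal D * (2 ^ Module.finrank ℝ G * μ K * ∫⁻ z in K, ‖fderiv ℝ f z‖ₑ ∂μ) := by
  set d := Module.finrank ℝ G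
  set F : G → ℝ≥0∞ := K.indicator fun z => ‖fderiv ℝ f z‖ₑ with hF
  have hFm : Measurable F := (hf.continuous_fderiv (by simp)).enorm.measurable.indicator hK
  have hFi : ∫⁻ z, F z ∂μ = ∫⁻ z in K, ‖fderiv ℝ f z‖ₑ ∂μ := lintegral_indicator hK _
  have hpt : ∀ x ∈ K, ∀ y ∈ K, ‖f x - f y‖ₑ ≤
      ENNReal.ofReal D * ∫⁻ t in Icc (0 : ℝ) 1, F (x + t • (y - x)) := by
    intro x hx y hy
    have hγ : ContDiff ℝ 1 fun t : ℝ => f (x + t • (y - x)) :=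
      hf.comp (contDiff_const.add (contDiff_id.smul contDiff_const))
    have h1 := enorm_sub_le_lintegral_deriv_of_contDiffOn_Icc hγ.contDiffOn zero_le_one
    simp only [one_smul, zero_smul, add_zero, add_sub_cancel] at h1
    rw [← lintegral_const_mul' _ _ ENNReal.ofReal_ne_top, ← enorm_neg, neg_sub]
    refine h1.trans (setLIntegral_mono_ae' measurableSet_Icc (Eventually.of_forall fun t ht => ?_))
    have hmem : x + t • (y - x) ∈ K := hKc.add_smul_sub_mem hx hy ht
    have hd : HasDerivAt (fun t : ℝ => f (x + t • (y - x)))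
        (fderiv ℝ f (x + t • (y - x)) (y - x)) t := by
      have h2 : HasDerivAt (fun t : ℝ => x + t • (y - x)) (y - x) t := by
        simpa using ((hasDerivAt_id t).smul_const (y - x)).const_add x
      exact (hf.differentiable (by simp) _).hasFDerivAt.comp_hasDerivAt t h2
    rw [hd.deriv, hF, indicator_of_mem hmem, mul_comm]
    calc _ ≤ ‖fderiv ℝ f (x + t • (y - x))‖ₑ * ‖y - x‖ₑ := ContinuousLinearMap.le_opENorm _ _
      _ ≤ _ := by
        gcongr
        rw [← ofReal_norm]
        exact ENNReal.ofReal_le_ofReal (hD x hx y hy)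
  have hFm3 : Measurable fun q : (G × G) × ℝ => F (q.1.1 + q.2 • (q.1.2 - q.1.1)) :=
    hFm.comp (by fun_prop)
  -- The point `(1 - t) x + t y` is used as a new variable in place of `y` when `t ≥ 1/2` and in
  -- place of `x` when `t ≤ 1/2`. The Jacobian factor is then at most `2 ^ d`, avoiding the
  -- singularities at both ends.
  have hslice : ∀ t ∈ Icc (0 : ℝ) 1, ∫⁻ x in K, ∫⁻ y in K, F (x + t • (y - x)) ∂μ ∂μ ≤
      2 ^ d * μ K * ∫⁻ z, F z ∂μ := by
    intro t ht
    have hbound : ∀ s : ℝ, 1 / 2 ≤ s → ∀ c : G,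
        ∫⁻ y in K, F (c + s • y) ∂μ ≤ 2 ^ d * ∫⁻ z, F z ∂μ := by
      intro s hs c
      refine (setLIntegral_le_lintegral _ _).trans ?_
      rw [lintegral_comp_add_smul μ hFm c (by linarith)]
      gcongr
      rw [abs_of_nonneg (by positivity), ← inv_pow, ENNReal.ofReal_pow (by positivity)]
      gcongr
      rw [show (2 : ℝ≥0∞) = ENNReal.ofReal 2 by simp]
      refine ENNReal.ofReal_le_ofReal ?_
      rw [inv_le_comm₀ (by linarith) (by norm_num)]
      linarith
    have hconst : ∀ H : G → ℝ≥0∞, (∀ x, H x ≤ 2 ^ d * ∫⁻ z, F z ∂μ) →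
        ∫⁻ x in K, H x ∂μ ≤ 2 ^ d * μ K * ∫⁻ z, F z ∂μ := by
      intro H hH
      refine (lintegral_mono hH).trans (le_of_eq ?_)
      rw [lintegral_const, Measure.restrict_apply_univ]
      ring
    rcases le_total (1 / 2) t with h | h
    · refine hconst _ fun x => ?_
      have := hbound t h ((1 - t) • x)
      refine le_trans (le_of_eq ?_) this
      congr 1; funext y
      congr 1
      module
    · rw [lintegral_lintegral_swap]
      · refine hconst _ fun y => ?_
        have := hbound (1 - t) (by linarith) (t • y)
        refine le_trans (le_of_eq ?_) this
        congr 1; funext x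
        congr 1
        module
      · exact (hFm3.comp (measurable_id.prodMk measurable_const)).aemeasurable
  calc _ ≤ ∫⁻ x in K, ∫⁻ y in K, ENNReal.ofReal D *
          (∫⁻ t in Icc (0 : ℝ) 1, F (x + t • (y - x))) ∂μ ∂μ :=
        setLIntegral_mono_ae' hK (Eventually.of_forall fun x hx =>
          setLIntegral_mono_ae' hK (Eventually.of_forall fun y hy => hpt x hx y hy))
    _ = ENNReal.ofReal D * ∫⁻ x in K, ∫⁻ y in K,
          (∫⁻ t in Icc (0 : ℝ) 1, F (x + t • (y - x))) ∂μ ∂μ := by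
        rw [← lintegral_const_mul' _ _ ENNReal.ofReal_ne_top]
        refine lintegral_congr fun x => ?_
        rw [lintegral_const_mul' _ _ ENNReal.ofReal_ne_top]
    _ = ENNReal.ofReal D * ∫⁻ t in Icc (0 : ℝ) 1, ∫⁻ x in K, ∫⁻ y in K,
          F (x + t • (y - x)) ∂μ ∂μ := by
        congr 1
        have e1 : ∀ x, ∫⁻ y in K, (∫⁻ t in Icc (0 : ℝ) 1, F (x + t • (y - x))) ∂μ =
            ∫⁻ t in Icc (0 : ℝ) 1, ∫⁻ y in K, F (x + t • (y - x)) ∂μ := fun x =>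
          lintegral_lintegral_swap (hFm3.comp (f := fun q : G × ℝ => ((x, q.1), q.2))
            (by fun_prop)).aemeasurable
        simp_rw [e1]
        refine lintegral_lintegral_swap (Measurable.aemeasurable ?_)
        exact Measurable.lintegral_prod_right' (f := fun q : (G × ℝ) × G =>
          F (q.1.1 + q.1.2 • (q.2 - q.1.1))) (hFm.comp (by fun_prop))
    _ ≤ ENNReal.ofReal D * ∫⁻ _ in Icc (0 : ℝ) 1, 2 ^ d * μ K * ∫⁻ z, F z ∂μ := by
        gcongr ENNReal.ofReal D * ?_
        exact setLIntegral_mono_ae' measurableSet_Icc (Eventually.of_forall hslice)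
    _ = _ := by
        simp [hFi]

end Poincare

theorem convex_cube (N : ℕ) (r : ℝ) : Convex ℝ (cube N r) := by
  have : cube N r = ⋂ i, (fun x : EuclideanSpace ℝ (Fin N) => x i) ⁻¹' Metric.ball 0 (r / 2) := by
    ext x; simp [cube]
  rw [this]
  exact convex_iInter fun i => (convex_ball (0 : ℝ) (r / 2)).is_linear_preimage ⟨by simp, by simp⟩

theorem EuclideanSpace.norm_le_sum_abs {N : ℕ} (x : EuclideanSpace ℝ (Fin N)) :
    ‖x‖ ≤ ∑ i, |x i| := by
  conv_lhs => rw [← (EuclideanSpace.basisFun (Fin N) ℝ).sum_repr x]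
  refine (norm_sum_le _ _).trans (Finset.sum_le_sum fun i _ => ?_)
  rw [norm_smul, (EuclideanSpace.basisFun (Fin N) ℝ).norm_eq_one]
  simp

theorem norm_sub_le_of_mem_cube {N : ℕ} {r : ℝ} {x y : EuclideanSpace ℝ (Fin N)}
    (hx : x ∈ cube N r) (hy : y ∈ cube N r) : ‖y - x‖ ≤ N * r := by
  refine (EuclideanSpace.norm_le_sum_abs _).trans ?_
  calc _ ≤ ∑ _i : Fin N, r := Finset.sum_le_sum fun i _ => by
        have := hx i
        have := hy i
        rw [PiLp.sub_apply]
        linarith [abs_sub (y i) (x i)]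
    _ = _ := by simp

/-! ### Logarithmic estimate -/

namespace IsRegularizedSupersolution

variable {N : ℕ} {K : Set (EuclideanSpace ℝ (Fin N))} {p C₀ C₁ : ℝ}
  {v : EuclideanSpace ℝ (Fin N) → ℝ} {V a : EuclideanSpace ℝ (Fin N) → EuclideanSpace ℝ (Fin N)}
  {w : ℕ → EuclideanSpace ℝ (Fin N) → ℝ}

/-- The Poincaré inequality holds for the smooth functions `log (w n + k)`. On the left Fatou's
lemma, applied in each variable, suffices; on the right the gradients converge in `L^1`, because the
factors `1 / (w n + k)` are bounded by `1 / k`. -/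
theorem lintegral_lintegral_log_sub_le (h : IsRegularizedSupersolution K p C₀ C₁ v V a w)
    (hp : 1 ≤ p) {s : ℝ} (hsK : cube N s ⊆ K) {k : ℝ} (hk : 0 < k) :
    ∫⁻ x in cube N s, ∫⁻ y in cube N s, ‖Real.log (v x + k) - Real.log (v y + k)‖ₑ ≤
      ENNReal.ofReal (N * s) * (2 ^ N * volume (cube N s) *
        ∫⁻ x in cube N s, ‖(1 / (v x + k)) • V x‖ₑ) := by
  have hp1 : (1 : ℝ≥0∞) ≤ ENNReal.ofReal p := by simpa using hp
  have hQm : MeasurableSet (cube N s) := (isOpen_cube N s).measurableSet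
  set Q := cube N s with hQ
  have hKfin : volume K ≠ ⊤ := h.isCompact.measure_lt_top.ne
  have hQfin : volume Q ≠ ⊤ := measure_ne_top_of_subset hsK hKfin
  have : IsFiniteMeasure (volume.restrict Q) := ⟨by simpa using hQfin.lt_top⟩
  have hwc : ∀ n, Continuous (w n) := fun n => (h.contDiff_approx n).continuous
  have hwk : ∀ n x, 0 < w n x + k := fun n x => by linarith [h.approx_nonneg n x]
  have hvk : ∀ x, 0 < v x + k := fun x => by linarith [h.nonneg x]
  have hgc : ∀ n, Continuous (∇ (w n)) := fun n =>
    (h.contDiff_approx n).continuous_gradient (by norm_cast)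
  have hlog : ∀ n, ContDiff ℝ 1 fun x => Real.log (w n x + k) := fun n =>
    (((h.contDiff_approx n).of_le (by norm_cast)).add contDiff_const).log fun x => (hwk n x).ne'
  have hVQ : MemLp V (ENNReal.ofReal p) (volume.restrict Q) :=
    h.memLp_grad.mono_measure (Measure.restrict_mono hsK le_rfl)
  have hV1 : MemLp V (ENNReal.ofReal 1) (volume.restrict Q) := by
    rw [ENNReal.ofReal_one]; exact hVQ.mono_exponent hp1
  have hwv : ∀ᵐ x ∂volume.restrict Q, Tendsto (fun n => w n x) atTop (𝓝 (v x)) :=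
    ae_restrict_of_ae_restrict_of_subset hsK h.tendsto_approx
  have hg1 : Tendsto (fun n => eLpNorm (fun x => ∇ (w n) x - V x) (ENNReal.ofReal 1)
      (volume.restrict Q)) atTop (𝓝 0) := by
    have t := ENNReal.Tendsto.mul_const h.tendsto_grad_approx
      (b := volume.restrict Q univ ^ (1 / (ENNReal.ofReal 1).toReal - 1 / (ENNReal.ofReal p).toReal))
      (Or.inr (ENNReal.rpow_ne_top_of_nonneg (by
        rw [ENNReal.toReal_ofReal (zero_le_one.trans hp)]
        simpa using inv_le_one_of_one_le₀ hp) (measure_ne_top _ _)))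
    rw [zero_mul] at t
    refine tendsto_of_tendsto_of_tendsto_of_le_of_le tendsto_const_nhds t (fun _ => bot_le)
      fun n => ?_
    refine (eLpNorm_le_eLpNorm_mul_rpow_measure_univ (ENNReal.ofReal_le_ofReal hp)
      ((hgc n).aestronglyMeasurable.sub hVQ.1)).trans ?_
    gcongr
    exact eLpNorm_mono_measure _ (Measure.restrict_mono hsK le_rfl)
  have hlim := tendsto_eLpNorm_smul_sub_smul (μ := volume.restrict Q) le_rfl (M := 1 / k)
    (b := fun n x => 1 / (w n x + k)) (b' := fun x => 1 / (v x + k))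
    (g := fun n => ∇ (w n)) (g' := V)
    (fun n => (continuous_const.div ((hwc n).add continuous_const)
      fun x => (hwk n x).ne').aestronglyMeasurable)
    (fun n => Eventually.of_forall fun x => by
      rw [abs_of_pos (one_div_pos.2 (hwk n x))]
      exact one_div_le_one_div_of_le hk (by linarith [h.approx_nonneg n x]))
    (hwv.mono fun x hx => (tendsto_const_nhds.div (hx.add_const k) (hvk x).ne'))
    (fun n => (hgc n).aestronglyMeasurable) hV1 hg1
  simp only [ENNReal.ofReal_one, eLpNorm_one_eq_lintegral_enorm] at hlim
  set T := ∫⁻ x in Q, ‖(1 / (v x + k)) • V x‖ₑ with hT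
  have hn : ∀ n, ∫⁻ x in Q, ∫⁻ y in Q, ‖Real.log (w n x + k) - Real.log (w n y + k)‖ₑ ≤
      ENNReal.ofReal (N * s) * (2 ^ N * volume Q *
        ((∫⁻ x in Q, ‖(1 / (w n x + k)) • ∇ (w n) x - (1 / (v x + k)) • V x‖ₑ) + T)) := by
    intro n
    have h1 := lintegral_lintegral_enorm_sub_le volume hQm (convex_cube N s)
      (fun x hx y hy => norm_sub_le_of_mem_cube hx hy) (hlog n)
    rw [finrank_euclideanSpace_fin] at h1
    refine h1.trans ?_
    gcongr ENNReal.ofReal (N * s) * (2 ^ N * volume Q * ?_)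
    have hbV : Measurable fun x => ‖(1 / (v x + k)) • V x‖ₑ :=
      ((measurable_const.div (h.measurable_fun.add measurable_const)).smul h.measurable_grad).enorm
    rw [hT, ← lintegral_add_right _ hbV]
    refine lintegral_mono fun x => ?_
    have e : ‖fderiv ℝ (fun x => Real.log (w n x + k)) x‖ₑ = ‖(1 / (w n x + k)) • ∇ (w n) x‖ₑ := by
      have hd : HasFDerivAt (fun x => w n x + k) (fderiv ℝ (w n) x) x :=
        ((h.contDiff_approx n).differentiable (by simp) x).hasFDerivAt.add_const k
      rw [(hd.log (hwk n x).ne').fderiv, enorm_smul, enorm_smul, one_div]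
      congr 1
      rw [enorm_eq_iff_norm_eq, norm_gradient]
    rw [e]
    calc _ = ‖((1 / (w n x + k)) • ∇ (w n) x - (1 / (v x + k)) • V x) + (1 / (v x + k)) • V x‖ₑ := by
          rw [sub_add_cancel]
      _ ≤ _ := enorm_add_le _ _
  have hR : Tendsto (fun n => ENNReal.ofReal (N * s) * (2 ^ N * volume Q *
        ((∫⁻ x in Q, ‖(1 / (w n x + k)) • ∇ (w n) x - (1 / (v x + k)) • V x‖ₑ) + T)))
      atTop (𝓝 (ENNReal.ofReal (N * s) * (2 ^ N * volume Q * (0 + T)))) := by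
    refine ENNReal.Tendsto.const_mul (ENNReal.Tendsto.const_mul (hlim.add_const T)
      (Or.inr ?_)) (Or.inr ENNReal.ofReal_ne_top)
    exact ENNReal.mul_ne_top (by simp) hQfin
  have hmeas : ∀ n, Measurable fun q : EuclideanSpace ℝ (Fin N) × EuclideanSpace ℝ (Fin N) =>
      ‖Real.log (w n q.1 + k) - Real.log (w n q.2 + k)‖ₑ := fun n =>
    (((hlog n).continuous.comp continuous_fst).sub
      ((hlog n).continuous.comp continuous_snd)).enorm.measurable
  calc _ ≤ ∫⁻ x in Q, liminf (fun n => ∫⁻ y in Q,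
          ‖Real.log (w n x + k) - Real.log (w n y + k)‖ₑ) atTop := by
        refine lintegral_mono_ae (hwv.mono fun x hx => ?_)
        refine le_trans (lintegral_mono_ae (hwv.mono fun y hy => ?_))
          (lintegral_liminf_le fun n => (hmeas n).comp measurable_prodMk_left)
        refine le_of_eq (Tendsto.liminf_eq ?_).symm
        exact (((hx.add_const k).log (hvk x).ne').sub ((hy.add_const k).log (hvk y).ne')).enorm
    _ ≤ liminf (fun n => ∫⁻ x in Q, ∫⁻ y in Q,
          ‖Real.log (w n x + k) - Real.log (w n y + k)‖ₑ) atTop :=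
        lintegral_liminf_le fun n => (hmeas n).lintegral_prod_right'
    _ ≤ liminf (fun n => ENNReal.ofReal (N * s) * (2 ^ N * volume Q *
          ((∫⁻ x in Q, ‖(1 / (w n x + k)) • ∇ (w n) x - (1 / (v x + k)) • V x‖ₑ) + T))) atTop :=
        liminf_le_liminf (Eventually.of_forall hn)
    _ = _ := by rw [hR.liminf_eq, zero_add]

end IsRegularizedSupersolution

/-- Pointwise substitute for Hölder's inequality: integrated over a cube of side comparable to `r`,
it passes from an `L^p` energy to an `L^1` norm with the correct scaling. -/
theorem le_rpow_mul_rpow_add_inv {p r t : ℝ} (hp : 1 < p) (hr : 0 < r) (ht : 0 ≤ t) :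
    t ≤ r ^ (p - 1) * t ^ p + r⁻¹ := by
  rcases le_total t r⁻¹ with h | h
  · have : 0 ≤ r ^ (p - 1) * t ^ p := by positivity
    linarith
  · have ht0 : 0 < t := (inv_pos.2 hr).trans_le h
    have h1 : 1 ≤ (r * t) ^ (p - 1) := by
      refine Real.one_le_rpow ?_ (by linarith)
      rwa [inv_le_iff_one_le_mul₀ hr, mul_comm] at h
    have h2 : r ^ (p - 1) * t ^ p = (r * t) ^ (p - 1) * t := by
      rw [Real.mul_rpow hr.le ht, mul_assoc, ← Real.rpow_add_one ht0.ne', sub_add_cancel]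
    have : 0 ≤ r⁻¹ := by positivity
    rw [h2]
    nlinarith

/-- The logarithmic estimate: large values on a large set force small values on a small set. -/
theorem exists_log_estimate (N : ℕ) {p C₀ C₁ : ℝ} (hp : 1 < p) (hC₀ : 0 < C₀) (hC₁ : 0 < C₁) :
    ∃ C : ℝ, 0 < C ∧ ∀ r : ℝ, 0 < r → ∀ (v : EuclideanSpace ℝ (Fin N) → ℝ)
      (V a : EuclideanSpace ℝ (Fin N) → EuclideanSpace ℝ (Fin N))
      (w : ℕ → EuclideanSpace ℝ (Fin N) → ℝ),
      IsRegularizedSupersolution (closedCube N (7 / 4 * r)) p C₀ C₁ v V a w →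
      ∀ k t : ℝ, 0 < k → k ≤ t →
        volume.real (cube N (3 / 2 * r) ∩ {x | t ≤ v x}) *
          volume.real (cube N (3 / 2 * r) ∩ {x | v x < k}) * Real.log ((t + k) / (2 * k)) ≤
            C * (r ^ N) ^ 2 := by
  obtain ⟨L, hL, hcut⟩ := exists_cutoff N hp.le
  have hp0 : 0 < p - 1 := by linarith
  set c : ℝ := (2 * (C₁ * (L * 4) * (1 / (p - 1))) / C₀) ^ p with hc
  have hc0 : 0 ≤ c := by positivity
  refine ⟨N * (3 / 2) * (2 ^ N * (3 / 2) ^ N * ((c + 1) * (7 / 4) ^ N)) + 1, by positivity,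
    fun r hr v V a w h k t hk hkt => ?_⟩
  set K := closedCube N (7 / 4 * r) with hK
  set Q := cube N (3 / 2 * r) with hQ
  have hQK : Q ⊆ K := cube_subset_closedCube N (by linarith)
  have hQm : MeasurableSet Q := (isOpen_cube N _).measurableSet
  have hvk : ∀ x, 0 < v x + k := fun x => by linarith [h.nonneg x]
  have hKv : volume K = ENNReal.ofReal ((7 / 4 * r) ^ N) := by
    rw [hK, volume_closedCube, ENNReal.ofReal_pow (by positivity)]
  have hQv : volume Q = ENNReal.ofReal ((3 / 2 * r) ^ N) := by
    rw [hQ, volume_cube, ENNReal.ofReal_pow (by positivity)]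
  obtain ⟨ζ, hζ, hζ0, hζ1, hζQ, hζL⟩ := hcut (3 / 2 * r) (7 / 4 * r) (by linarith)
  have hLr : L / (7 / 4 * r - 3 / 2 * r) = L * 4 / r := by field_simp; ring
  rw [hLr] at hζL
  -- Then `-g' = (s + k)^(-p)`, so the energy is exactly that of `log (v + k)`, and `g =
  -- (-g')^((p-1)/p) / (p - 1)` holds with equality. The resulting bound involves neither `k` nor
  -- `v`.
  set g : ℝ → ℝ := fun s => (s + k) ^ (1 - p) / (p - 1) with hg
  have hgd : ∀ s, 0 ≤ s → deriv g s = -(s + k) ^ (-p) := by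
    intro s hs
    have h1 : HasDerivAt (fun s : ℝ => s + k) 1 s := (hasDerivAt_id s).add_const k
    have h2 := (h1.rpow_const (p := 1 - p) (Or.inl (by linarith))).div_const (p - 1)
    rw [h2.deriv, show 1 - p - 1 = -p by ring]
    field_simp
    ring
  have hgs : ∀ s, 0 ≤ s → ContDiffAt ℝ ∞ g s := fun s hs =>
    ((contDiffAt_id.add contDiffAt_const).rpow_const_of_ne (by
      simp only [id]; linarith)).div_const _
  have hmono : ∀ e : ℝ, e ≤ 0 → ∀ s, 0 ≤ s → (s + k) ^ e ≤ k ^ e := fun e he s hs =>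
    Real.rpow_le_rpow_of_nonpos hk (by linarith) he
  have hE := h.lintegral_energy_le hp hC₀ hC₁ (g := g) (M := 1 / (p - 1)) (L := L * 4 / r)
    (B := max (k ^ (1 - p) / (p - 1)) (k ^ (-p))) hgs
    (fun s hs => div_nonneg (Real.rpow_nonneg (by linarith) _) hp0.le)
    (fun s hs => by
      have : 0 < s + k := by linarith
      rw [abs_of_nonneg (div_nonneg (Real.rpow_nonneg this.le _) hp0.le)]
      refine le_trans ?_ (le_max_left _ _)
      change (s + k) ^ (1 - p) / (p - 1) ≤ _
      exact div_le_div_of_nonneg_right (hmono (1 - p) (by linarith) s hs) hp0.le)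
    (fun s hs => by
      have : 0 < s + k := by linarith
      rw [hgd s hs, abs_neg, abs_of_nonneg (by positivity)]
      exact (hmono _ (by linarith) s hs).trans (le_max_right _ _))
    (fun s hs => by
      have : 0 < s + k := by linarith
      rw [hgd s hs, neg_nonpos]; positivity) (by positivity)
    (fun s hs => by
      have h0 : 0 < s + k := by linarith
      rw [hgd s hs, neg_neg, ← Real.rpow_mul h0.le, show -p * ((p - 1) / p) = 1 - p by
        field_simp; ring]
      simp only [hg]
      exact le_of_eq (by ring))
    hζ hζ0 (by positivity) hζL MeasurableSet.univ (fun x hx => absurd (mem_univ x) hx)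
  rw [Measure.restrict_apply_univ, hKv, ← ENNReal.ofReal_mul (by positivity)] at hE
  have hcr : (2 * (C₁ * (L * 4 / r) * (1 / (p - 1))) / C₀) ^ p = c / r ^ p := by
    rw [hc, ← Real.div_rpow (by positivity) hr.le]
    congr 1
    ring
  rw [hcr] at hE
  have hT : ∫⁻ x in Q, ‖(1 / (v x + k)) • V x‖ₑ ≤
      ENNReal.ofReal ((c + 1) * (7 / 4) ^ N * r ^ N / r) := by
    calc _ ≤ ∫⁻ x in Q, (ENNReal.ofReal (r ^ (p - 1)) *
            ENNReal.ofReal (ζ x * (- deriv g (v x)) * ‖V x‖ ^ p) + ENNReal.ofReal r⁻¹) := by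
          refine setLIntegral_mono_ae' hQm (Eventually.of_forall fun x hx => ?_)
          rw [← ofReal_norm, ← ENNReal.ofReal_mul (by positivity), ← ENNReal.ofReal_add
            (by
              have h1 := hζ0 x
              have h2 := hvk x
              rw [hgd _ (h.nonneg x), neg_neg]; positivity) (by positivity)]
          refine ENNReal.ofReal_le_ofReal ((le_rpow_mul_rpow_add_inv hp hr (norm_nonneg _)).trans
            (le_of_eq ?_))
          rw [norm_smul, Real.norm_of_nonneg (by have := hvk x; positivity),
            Real.mul_rpow (by have := hvk x; positivity) (norm_nonneg _), hζQ x hx,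
            hgd _ (h.nonneg x), neg_neg, one_mul, one_div, Real.inv_rpow (hvk x).le,
            Real.rpow_neg (hvk x).le]
      _ = ENNReal.ofReal (r ^ (p - 1)) *
            (∫⁻ x in Q, ENNReal.ofReal (ζ x * (- deriv g (v x)) * ‖V x‖ ^ p)) +
            ENNReal.ofReal r⁻¹ * volume Q := by
          rw [lintegral_add_right _ measurable_const, lintegral_const_mul' _ _
            ENNReal.ofReal_ne_top, lintegral_const, Measure.restrict_apply_univ]
      _ ≤ ENNReal.ofReal (r ^ (p - 1)) * ENNReal.ofReal (c / r ^ p * (7 / 4 * r) ^ N) +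
            ENNReal.ofReal r⁻¹ * ENNReal.ofReal ((7 / 4 * r) ^ N) := by
          gcongr
          · exact (lintegral_mono_set hQK).trans hE
          · exact (measure_mono hQK).trans_eq hKv
      _ = ENNReal.ofReal ((c + 1) * (7 / 4) ^ N * r ^ N / r) := by
          rw [← ENNReal.ofReal_mul (by positivity), ← ENNReal.ofReal_mul (by positivity),
            ← ENNReal.ofReal_add (by positivity) (by positivity)]
          congr 1
          rw [Real.rpow_sub_one hr.ne', mul_pow]
          have : 0 < r ^ p := by positivity
          field_simp
  have hP := h.lintegral_lintegral_log_sub_le hp.le hQK hk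
  set A := Q ∩ {x | t ≤ v x} with hA
  set B := Q ∩ {x | v x < k} with hB
  have hAm : MeasurableSet A := hQm.inter (measurableSet_le measurable_const h.measurable_fun)
  have hBm : MeasurableSet B := hQm.inter (measurableSet_lt h.measurable_fun measurable_const)
  set ℓ := Real.log ((t + k) / (2 * k)) with hℓ
  -- On `A × B` the two logarithms differ by at least `log (t + k) - log (2 k)`.
  have hlow : ENNReal.ofReal ℓ * volume B * volume A ≤
      ∫⁻ x in Q, ∫⁻ y in Q, ‖Real.log (v x + k) - Real.log (v y + k)‖ₑ := by
    calc _ = ∫⁻ _ in A, ∫⁻ _ in B, ENNReal.ofReal ℓ := by simp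
      _ ≤ ∫⁻ x in A, ∫⁻ y in B, ‖Real.log (v x + k) - Real.log (v y + k)‖ₑ := by
          refine setLIntegral_mono_ae' hAm (Eventually.of_forall fun x hx =>
            setLIntegral_mono_ae' hBm (Eventually.of_forall fun y hy => ?_))
          rw [← ofReal_norm]
          refine ENNReal.ofReal_le_ofReal (le_trans ?_ (Real.le_norm_self _))
          rw [hℓ, Real.log_div (by linarith) (by linarith)]
          have h1 : Real.log (t + k) ≤ Real.log (v x + k) :=
            Real.log_le_log (by linarith) (by have : t ≤ v x := hx.2
                                              linarith)
          have h2 : Real.log (v y + k) ≤ Real.log (2 * k) :=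
            Real.log_le_log (hvk y) (by have : v y < k := hy.2
                                        linarith)
          linarith
      _ ≤ ∫⁻ x in Q, ∫⁻ y in B, ‖Real.log (v x + k) - Real.log (v y + k)‖ₑ :=
          lintegral_mono_set inter_subset_left
      _ ≤ _ := lintegral_mono fun x => lintegral_mono_set inter_subset_left
  have hℓ0 : 0 ≤ ℓ := Real.log_nonneg (by rw [le_div_iff₀ (by linarith)]; linarith)
  have hAf : volume A ≠ ⊤ := measure_ne_top_of_subset inter_subset_left (by rw [hQv]; simp)
  have hBf : volume B ≠ ⊤ := measure_ne_top_of_subset inter_subset_left (by rw [hQv]; simp)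
  have hfin : ENNReal.ofReal ℓ * volume B * volume A ≤ ENNReal.ofReal
      (N * (3 / 2 * r) * (2 ^ N * (3 / 2 * r) ^ N * ((c + 1) * (7 / 4) ^ N * r ^ N / r))) := by
    refine (hlow.trans hP).trans ?_
    rw [ENNReal.ofReal_mul (p := N * (3 / 2 * r)) (by positivity),
      ENNReal.ofReal_mul (p := 2 ^ N * (3 / 2 * r) ^ N) (by positivity),
      ENNReal.ofReal_mul (p := 2 ^ N) (by positivity),
      ENNReal.ofReal_pow (p := 2) (by positivity), ← hQv]
    gcongr
    simp
  have hreal := ENNReal.toReal_mono ENNReal.ofReal_ne_top hfin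
  rw [ENNReal.toReal_mul, ENNReal.toReal_mul, ENNReal.toReal_ofReal hℓ0,
    ENNReal.toReal_ofReal (by positivity)] at hreal
  calc _ = ℓ * volume.real B * volume.real A := by ring
    _ ≤ _ := hreal
    _ = N * (3 / 2) * (2 ^ N * (3 / 2) ^ N * ((c + 1) * (7 / 4) ^ N)) * (r ^ N) ^ 2 := by
        rw [mul_pow]; field_simp
    _ ≤ _ := by gcongr; linarith

/-! ### De Giorgi iteration -/

theorem expNegInvGlue.le_one (x : ℝ) : expNegInvGlue x ≤ 1 := by
  rcases le_or_gt x 0 with h | h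
  · rw [expNegInvGlue.zero_of_nonpos h]; exact zero_le_one
  · rw [expNegInvGlue, if_neg h.not_ge, Real.exp_le_one_iff]
    exact neg_nonpos.2 (inv_nonneg.2 h.le)

theorem expNegInvGlue.deriv_eq (x : ℝ) : deriv expNegInvGlue x = expNegInvGlue x / x ^ 2 := by
  rcases le_or_gt x 0 with h | h
  · rw [expNegInvGlue.zero_of_nonpos h, zero_div]
    refine IsLocalMin.deriv_eq_zero (Eventually.of_forall fun y => ?_)
    rw [expNegInvGlue.zero_of_nonpos h]
    exact expNegInvGlue.nonneg y
  · have e : expNegInvGlue =ᶠ[𝓝 x] fun y => Real.exp (-y⁻¹) := by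
      filter_upwards [lt_mem_nhds h] with y hy
      rw [expNegInvGlue, if_neg (not_le.2 hy)]
    have hd := (hasDerivAt_inv h.ne').neg.exp
    rw [e.deriv_eq, e.eq_of_nhds]
    refine hd.deriv.trans ?_
    simp [div_eq_mul_inv]

theorem expNegInvGlue.deriv_nonneg (x : ℝ) : 0 ≤ deriv expNegInvGlue x := by
  rw [expNegInvGlue.deriv_eq]
  exact div_nonneg (expNegInvGlue.nonneg x) (sq_nonneg x)

theorem expNegInvGlue.deriv_le_one (x : ℝ) : deriv expNegInvGlue x ≤ 1 := by
  rw [expNegInvGlue.deriv_eq]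
  rcases le_or_gt x 0 with h | h
  · rw [expNegInvGlue.zero_of_nonpos h, zero_div]; exact zero_le_one
  · rw [div_le_one (by positivity), expNegInvGlue, if_neg h.not_ge, Real.exp_neg]
    refine inv_le_of_inv_le₀ (by positivity) ?_
    rw [← inv_pow]
    have hx : 0 ≤ x⁻¹ := inv_nonneg.2 h.le
    generalize x⁻¹ = y at hx ⊢
    have h5 := Real.sum_le_exp_of_nonneg hx 4
    norm_num [Finset.sum_range_succ, Nat.factorial] at h5
    nlinarith [mul_nonneg hx (sq_nonneg (y - 3 / 2))]

/-- For positive `x` the function equals `x ^ 2` times its derivative, and being at most 1 it only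
grows when raised to the power `e ≤ 1`. This supplies the structural condition on `g` in the energy
estimate. -/
theorem expNegInvGlue.le_rpow_deriv {e T x : ℝ} (he : 0 < e) (he1 : e ≤ 1) (hxT : x ≤ T) :
    expNegInvGlue x ≤ (T ^ 2 * deriv expNegInvGlue x) ^ e := by
  rcases le_or_gt x 0 with h | h
  · rw [expNegInvGlue.zero_of_nonpos h]
    exact Real.rpow_nonneg (mul_nonneg (sq_nonneg T) (expNegInvGlue.deriv_nonneg x)) e
  · have h0 := expNegInvGlue.pos_of_pos h
    calc expNegInvGlue x = expNegInvGlue x ^ (1 : ℝ) := (Real.rpow_one _).symm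
      _ ≤ expNegInvGlue x ^ e :=
        Real.rpow_le_rpow_of_exponent_ge h0 (expNegInvGlue.le_one x) he1
      _ ≤ _ := by
        refine Real.rpow_le_rpow h0.le ?_ he.le
        rw [expNegInvGlue.deriv_eq, mul_div_assoc', le_div_iff₀ (by positivity), mul_comm]
        gcongr

namespace IsRegularizedSupersolution

variable {N : ℕ} {K : Set (EuclideanSpace ℝ (Fin N))} {p C₀ C₁ : ℝ}
  {v : EuclideanSpace ℝ (Fin N) → ℝ} {V a : EuclideanSpace ℝ (Fin N) → EuclideanSpace ℝ (Fin N)}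
  {w : ℕ → EuclideanSpace ℝ (Fin N) → ℝ}

/-- The Sobolev inequality for products `ζ g(v)`. -/
theorem eLpNorm_mul_comp_le (h : IsRegularizedSupersolution K p C₀ C₁ v V a w) (hp : 1 ≤ p)
    (hN : 0 < N) {p' : NNReal} (hp' : (p' : ℝ)⁻¹ = p⁻¹ - (N : ℝ)⁻¹)
    {g : ℝ → ℝ} {M : ℝ} (hg : ∀ s, 0 ≤ s → ContDiffAt ℝ ∞ g s) (hgM : ∀ s, 0 ≤ s → |g s| ≤ M)
    (hgM' : ∀ s, 0 ≤ s → |deriv g s| ≤ M) {ζ : EuclideanSpace ℝ (Fin N) → ℝ}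
    (hζ : IsTestFunction K ζ) :
    eLpNorm (fun x => ζ x * g (v x)) p' (volume.restrict K) ≤
      SNormLESNormFDerivOfEqConst ℝ (volume : Measure (EuclideanSpace ℝ (Fin N))) p *
      eLpNorm (fun x => g (v x) • ∇ ζ x + (ζ x * deriv g (v x)) • V x) (ENNReal.ofReal p)
        (volume.restrict K) := by
  have hp1 : (1 : ℝ≥0∞) ≤ ENNReal.ofReal p := by simpa using hp
  have hlim := h.tendsto_gradient_mul_comp hp hg hgM hgM' hζ.contDiff
  set X : EuclideanSpace ℝ (Fin N) → EuclideanSpace ℝ (Fin N) :=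
    fun x => g (v x) • ∇ ζ x + (ζ x * deriv g (v x)) • V x with hX
  set φ : ℕ → EuclideanSpace ℝ (Fin N) → ℝ := fun n y => ζ y * g (w n y) with hφ
  set C := SNormLESNormFDerivOfEqConst ℝ (volume : Measure (EuclideanSpace ℝ (Fin N))) p
  have hφd : ∀ n, ContDiff ℝ ∞ (φ n) := fun n =>
    hζ.contDiff.mul (contDiff_iff_contDiffAt.2 fun x =>
      (hg _ (h.approx_nonneg n x)).comp x (h.contDiff_approx n).contDiffAt)
  have hts : ∀ n, tsupport (φ n) ⊆ K := fun n =>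
    (tsupport_mul_subset_left).trans hζ.tsupport_subset
  have hgv : AEStronglyMeasurable (fun x => g (v x)) (volume.restrict K) := by
    refine aestronglyMeasurable_of_tendsto_ae atTop (f := fun n x => g (w n x)) (fun n => ?_)
      (h.tendsto_approx.mono fun x hx => ((hg _ (h.nonneg x)).continuousAt).tendsto.comp hx)
    exact (continuous_iff_continuousAt.2 fun x =>
      ContinuousAt.comp (f := w n) (hg _ (h.approx_nonneg n x)).continuousAt
        (h.contDiff_approx n).continuous.continuousAt).aestronglyMeasurable
  have hXm : AEStronglyMeasurable X (volume.restrict K) :=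
    (hgv.smul (hζ.contDiff.continuous_gradient (by norm_cast)).aestronglyMeasurable).add
      (((hζ.contDiff.continuous.measurable.mul
        ((measurable_deriv g).comp h.measurable_fun)).aestronglyMeasurable).smul h.memLp_grad.1)
  -- Sobolev's inequality is applied to the smooth approximations; lower semicontinuity of the
  -- `L^p'` norm under a.e. convergence then carries it to the limit.
  have hn : ∀ n, eLpNorm (φ n) p' (volume.restrict K) ≤
      C * (eLpNorm (fun x => ∇ (φ n) x - X x) (ENNReal.ofReal p) (volume.restrict K) +
        eLpNorm X (ENNReal.ofReal p) (volume.restrict K)) := by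
    intro n
    have h1 := eLpNorm_le_eLpNorm_fderiv_of_eq (F := ℝ)
      (volume : Measure (EuclideanSpace ℝ (Fin N))) ((hφd n).of_le (by norm_cast))
      (hζ.hasCompactSupport.mul_right (f' := fun y => g (w n y))) (p := p.toNNReal) (p' := p')
      (by simpa using hp) (by simpa using hN) (by
        rw [hp', NNReal.coe_inv, Real.coe_toNNReal _ (by linarith), finrank_euclideanSpace_fin])
    rw [Real.coe_toNNReal _ (by linarith)] at h1
    refine (eLpNorm_mono_measure _ Measure.restrict_le_self).trans (h1.trans ?_)
    gcongr C * ?_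
    have h2 : eLpNorm (fderiv ℝ (φ n)) (p.toNNReal : ℝ≥0∞) volume =
        eLpNorm (∇ (φ n)) (ENNReal.ofReal p) (volume.restrict K) := by
      rw [eLpNorm_restrict_eq_of_support_subset]
      · exact eLpNorm_congr_norm_ae (Eventually.of_forall fun x => (norm_gradient _ _).symm)
      · intro x hx
        by_contra hxK
        exact hx (gradient_eq_zero_of_notMem_tsupport fun ht => hxK (hts n ht))
    refine h2.le.trans ?_
    have h3 : ∇ (φ n) = (fun x => ∇ (φ n) x - X x) + X := by
      funext x; simp
    conv_lhs => rw [h3]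
    exact eLpNorm_add_le (((hφd n).continuous_gradient (by norm_cast)).aestronglyMeasurable.sub
      hXm) hXm hp1
  have hR : Tendsto (fun n => (C : ℝ≥0∞) * (eLpNorm (fun x => ∇ (φ n) x - X x) (ENNReal.ofReal p)
      (volume.restrict K) + eLpNorm X (ENNReal.ofReal p) (volume.restrict K))) atTop
      (𝓝 (C * (0 + eLpNorm X (ENNReal.ofReal p) (volume.restrict K)))) :=
    ENNReal.Tendsto.const_mul (hlim.add_const _) (Or.inr ENNReal.coe_ne_top)
  calc _ ≤ liminf (fun n => eLpNorm (φ n) p' (volume.restrict K)) atTop := by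
        refine Lp.eLpNorm_lim_le_liminf_eLpNorm
          (fun n => (hφd n).continuous.aestronglyMeasurable) _
          (h.tendsto_approx.mono fun x hx => ?_)
        exact (((hg _ (h.nonneg x)).continuousAt).tendsto.comp hx).const_mul _
    _ ≤ _ := (liminf_le_liminf (Eventually.of_forall hn))
    _ = _ := by rw [hR.liminf_eq, zero_add]

/-- One step of the De Giorgi iteration. -/
theorem volume_sublevel_step (h : IsRegularizedSupersolution K p C₀ C₁ v V a w) (hp : 1 < p)
    (hC₀ : 0 < C₀) (hC₁ : 0 < C₁) (hN : 0 < N) {p' : NNReal}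
    (hp' : (p' : ℝ)⁻¹ = p⁻¹ - (N : ℝ)⁻¹) (hp'0 : 0 < p') {r₁ r₂ L κ δ T : ℝ}
    {ζ : EuclideanSpace ℝ (Fin N) → ℝ} (hζ : IsTestFunction (closedCube N r₂) ζ)
    (hζ0 : ∀ x, 0 ≤ ζ x) (hζ1 : ∀ x, ζ x ≤ 1) (hζr : ∀ x ∈ closedCube N r₁, ζ x = 1)
    (hL : 0 ≤ L) (hζL : ∀ x, ‖∇ ζ x‖ ≤ L * ζ x ^ ((p - 1) / p)) (hr : r₁ ≤ r₂)
    (hK : closedCube N r₂ ⊆ K) (hδ : 0 < δ) (hT : 1 ≤ T) (hκ : κ ≤ T * δ) :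
    ENNReal.ofReal (Real.exp (-1)) *
        volume (closedCube N r₁ ∩ {x | v x < κ - δ}) ^ (1 / (p' : ℝ)) ≤
      SNormLESNormFDerivOfEqConst ℝ (volume : Measure (EuclideanSpace ℝ (Fin N))) p *
        ENNReal.ofReal (L * (1 + 2 * C₁ / C₀) * T ^ 2) *
          volume (closedCube N r₂ ∩ {x | v x < κ}) ^ (1 / p) := by
  have hp0 : 0 < p := by linarith
  have he : 0 < (p - 1) / p := div_pos (by linarith) hp0
  have he1 : (p - 1) / p ≤ 1 := by rw [div_le_one hp0]; linarith
  have hp1 : (1 : ℝ≥0∞) ≤ ENNReal.ofReal p := by simpa using hp.le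
  have hpne : ENNReal.ofReal p ≠ 0 := by simpa using hp0
  set Φ := expNegInvGlue with hΦ
  have hΦd : ContDiff ℝ ∞ Φ := expNegInvGlue.contDiff
  -- A smooth substitute for `(κ - s)₊ / δ`: zero above `κ`, at least `e^(-1)` below `κ - δ`. For `s
  -- ≥ 0` the argument is at most `κ / δ ≤ T`; this is where nonnegativity of the supersolution
  -- enters.
  set g : ℝ → ℝ := fun s => Φ ((κ - s) / δ) with hg
  have hgd : ContDiff ℝ ∞ g := hΦd.comp (by fun_prop)
  have hgd' : ∀ s, deriv g s = -(deriv Φ ((κ - s) / δ) / δ) := by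
    intro s
    have h1 : HasDerivAt (fun s : ℝ => (κ - s) / δ) (-1 / δ) s :=
      ((hasDerivAt_id s).const_sub κ).div_const δ
    have h2 := ((hΦd.differentiable (by simp)) ((κ - s) / δ)).hasDerivAt.comp s h1
    rw [show g = Φ ∘ fun s => (κ - s) / δ from rfl, h2.deriv]
    ring
  have hΦ'0 := expNegInvGlue.deriv_nonneg
  have hΦ'1 := expNegInvGlue.deriv_le_one
  have hg0 : ∀ s, 0 ≤ g s := fun s => expNegInvGlue.nonneg _
  have hg1 : ∀ s, g s ≤ 1 := fun s => expNegInvGlue.le_one _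
  have hgneg : ∀ s, 0 ≤ - deriv g s := fun s => by
    rw [hgd', neg_neg]; exact div_nonneg (hΦ'0 _) hδ.le
  have hgδ : ∀ s, - deriv g s ≤ 1 / δ := fun s => by
    rw [hgd', neg_neg]
    exact div_le_div_of_nonneg_right (hΦ'1 _) hδ.le
  have hgB : ∀ s, 0 ≤ s → |g s| ≤ max 1 (1 / δ) := fun s _ => by
    rw [abs_of_nonneg (hg0 s)]; exact (hg1 s).trans (le_max_left _ _)
  have hgB' : ∀ s, 0 ≤ s → |deriv g s| ≤ max 1 (1 / δ) := fun s _ => by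
    rw [← abs_neg, abs_of_nonneg (hgneg s)]; exact (hgδ s).trans (le_max_right _ _)
  set S := closedCube N r₂ ∩ {x | v x < κ} with hS
  have hSm : MeasurableSet S := (isClosed_closedCube N r₂).measurableSet.inter
    (measurableSet_lt h.measurable_fun measurable_const)
  have hSK : S ⊆ K := inter_subset_left.trans hK
  have hζK : IsTestFunction K ζ := ⟨hζ.contDiff, hζ.hasCompactSupport, hζ.tsupport_subset.trans hK⟩
  have hSg : ∀ x, x ∉ S → ζ x = 0 ∨ g (v x) = 0 := by
    intro x hx
    by_cases hxr : x ∈ closedCube N r₂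
    · right
      have hv : ¬ v x < κ := fun hv => hx ⟨hxr, hv⟩
      exact expNegInvGlue.zero_of_nonpos
        (div_nonpos_of_nonpos_of_nonneg (by linarith [not_lt.1 hv]) hδ.le)
    · left
      exact image_eq_zero_of_notMem_tsupport fun ht => hxr (hζ.tsupport_subset ht)
  set M := (T ^ 2 * δ) ^ ((p - 1) / p) with hM
  have hgM : ∀ s, 0 ≤ s → g s ≤ M * (- deriv g s) ^ ((p - 1) / p) := by
    intro s hs
    rw [hM, ← Real.mul_rpow (by positivity) (hgneg s), hgd', neg_neg,
      show T ^ 2 * δ * (deriv Φ ((κ - s) / δ) / δ) = T ^ 2 * deriv Φ ((κ - s) / δ) by field_simp]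
    refine expNegInvGlue.le_rpow_deriv he he1 ?_
    rw [div_le_iff₀ hδ]
    linarith
  have hE := h.lintegral_energy_le hp hC₀ hC₁ (fun s _ => hgd.contDiffAt) (fun s _ => hg0 s) hgB
    hgB' (fun s _ => by linarith [hgneg s]) (by positivity) hgM hζK hζ0 hL hζL hSm hSg
  rw [Measure.restrict_eq_self _ hSK] at hE
  set c := 2 * C₁ / C₀ with hc
  have hE1 : eLpNorm (fun x => (ζ x * deriv g (v x)) • V x) (ENNReal.ofReal p)
      (volume.restrict K) ≤ ENNReal.ofReal (L * c * T ^ 2) * volume S ^ (1 / p) := by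
    rw [eLpNorm_eq_lintegral_rpow_enorm_toReal hpne ENNReal.ofReal_ne_top,
      ENNReal.toReal_ofReal hp0.le]
    have h1 : ∫⁻ x in K, ‖(ζ x * deriv g (v x)) • V x‖ₑ ^ p ≤
        ENNReal.ofReal ((1 / δ) ^ (p - 1)) * (ENNReal.ofReal ((2 * (C₁ * L * M) / C₀) ^ p) *
          volume S) := by
      refine le_trans ?_ (mul_le_mul_right hE _)
      rw [← lintegral_const_mul' _ _ ENNReal.ofReal_ne_top]
      refine lintegral_mono fun x => ?_
      have hd := hgneg (v x)
      rw [← ofReal_norm, ENNReal.ofReal_rpow_of_nonneg (norm_nonneg _) hp0.le,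
        ← ENNReal.ofReal_mul (by positivity)]
      refine ENNReal.ofReal_le_ofReal ?_
      rw [norm_smul, norm_mul, Real.norm_of_nonneg (hζ0 x), ← norm_neg (deriv g (v x)),
        Real.norm_of_nonneg hd, Real.mul_rpow (mul_nonneg (hζ0 x) hd) (norm_nonneg _),
        Real.mul_rpow (hζ0 x) hd]
      have a1 : ζ x ^ p ≤ ζ x := Real.rpow_le_self_of_le_one (hζ0 x) (hζ1 x) hp.le
      have a2 : (- deriv g (v x)) ^ p ≤ (1 / δ) ^ (p - 1) * (- deriv g (v x)) := by
        rw [show p = (p - 1) + 1 by ring, Real.rpow_add_one' hd (by linarith)]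
        rw [show p - 1 + 1 - 1 = p - 1 by ring]
        gcongr
        exact hgδ _
      have a0 := hζ0 x
      calc _ ≤ ζ x * ((1 / δ) ^ (p - 1) * (- deriv g (v x))) * ‖V x‖ ^ p := by gcongr
        _ = _ := by ring
    -- The powers of `δ` cancel, since `M ^ p = (T ^ 2 * δ) ^ (p - 1)`; hence the level step enters
    -- only through the ratio bound `T`.
    have h2 : (1 / δ) ^ (p - 1) * (2 * (C₁ * L * M) / C₀) ^ p ≤ (L * c * T ^ 2) ^ p := by
      have hMp : M ^ p = (T ^ 2 * δ) ^ (p - 1) := by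
        rw [hM, ← Real.rpow_mul (by positivity), div_mul_cancel₀ _ hp0.ne']
      rw [show 2 * (C₁ * L * M) / C₀ = L * c * M by rw [hc]; ring,
        Real.mul_rpow (by positivity) (by positivity),
        Real.mul_rpow (x := L * c) (y := T ^ 2) (by positivity) (by positivity), hMp]
      have : (1 / δ) ^ (p - 1) * (T ^ 2 * δ) ^ (p - 1) = (T ^ 2) ^ (p - 1) := by
        rw [← Real.mul_rpow (by positivity) (by positivity)]
        congr 1; field_simp
      have h3 : (T ^ 2) ^ (p - 1) ≤ (T ^ 2) ^ p :=
        Real.rpow_le_rpow_of_exponent_le (one_le_pow₀ hT) (by linarith)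
      calc _ = (L * c) ^ p * ((1 / δ) ^ (p - 1) * (T ^ 2 * δ) ^ (p - 1)) := by ring
        _ ≤ _ := by rw [this]; gcongr
    calc _ ≤ (ENNReal.ofReal ((L * c * T ^ 2) ^ p) * volume S) ^ (1 / p) := by
          gcongr
          refine h1.trans ?_
          rw [← mul_assoc, ← ENNReal.ofReal_mul (by positivity)]
          gcongr
      _ = _ := by
          rw [ENNReal.mul_rpow_of_nonneg _ _ (by positivity),
            ← ENNReal.ofReal_rpow_of_nonneg (by positivity) hp0.le, ← ENNReal.rpow_mul,
            mul_one_div_cancel hp0.ne', ENNReal.rpow_one]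
  have hE2 : eLpNorm (fun x => g (v x) • ∇ ζ x) (ENNReal.ofReal p) (volume.restrict K) ≤
      ENNReal.ofReal L * volume S ^ (1 / p) := by
    calc _ ≤ eLpNorm (S.indicator fun _ => L) (ENNReal.ofReal p) (volume.restrict K) := by
          refine eLpNorm_mono fun x => ?_
          by_cases hx : x ∈ S
          · rw [indicator_of_mem hx, norm_smul, Real.norm_of_nonneg (hg0 _),
              Real.norm_of_nonneg hL]
            calc _ ≤ 1 * (L * 1) := by
                  refine mul_le_mul (hg1 _) ((hζL x).trans ?_) (norm_nonneg _) zero_le_one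
                  gcongr
                  exact Real.rpow_le_one (hζ0 x) (hζ1 x) he.le
              _ = L := by ring
          · rw [indicator_of_notMem hx, norm_zero, norm_le_zero_iff]
            rcases hSg x hx with h0 | h0
            · have := hζL x
              rw [h0, Real.zero_rpow he.ne', mul_zero] at this
              rw [norm_le_zero_iff.1 this, smul_zero]
            · rw [h0, zero_smul]
      _ = _ := by
          rw [eLpNorm_indicator_const hSm hpne ENNReal.ofReal_ne_top,
            ENNReal.toReal_ofReal hp0.le, Measure.restrict_eq_self _ hSK,
            Real.enorm_eq_ofReal hL]
  have hSob := h.eLpNorm_mul_comp_le hp.le hN hp' (fun s _ => hgd.contDiffAt) hgB hgB' hζK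
  set E := closedCube N r₁ ∩ {x | v x < κ - δ} with hEdef
  have hEm : MeasurableSet E := (isClosed_closedCube N r₁).measurableSet.inter
    (measurableSet_lt h.measurable_fun measurable_const)
  have hEK : E ⊆ K := inter_subset_left.trans ((closedCube_subset_closedCube N hr).trans hK)
  have hlow : ENNReal.ofReal (Real.exp (-1)) * volume E ^ (1 / (p' : ℝ)) ≤
      eLpNorm (fun x => ζ x * g (v x)) p' (volume.restrict K) := by
    calc _ = eLpNorm (E.indicator fun _ => Real.exp (-1)) p' (volume.restrict K) := by
          rw [eLpNorm_indicator_const hEm (by simpa using hp'0.ne') ENNReal.coe_ne_top,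
            Measure.restrict_eq_self _ hEK, Real.enorm_eq_ofReal (Real.exp_pos _).le]
          simp
      _ ≤ _ := by
          refine eLpNorm_mono fun x => ?_
          by_cases hx : x ∈ E
          · rw [indicator_of_mem hx, hζr x hx.1, one_mul, Real.norm_of_nonneg (hg0 _),
              Real.norm_of_nonneg (Real.exp_pos _).le]
            have h1 : (1 : ℝ) ≤ (κ - v x) / δ := by
              have : v x < κ - δ := hx.2
              rw [le_div_iff₀ hδ]; linarith
            refine le_trans (le_of_eq ?_) (expNegInvGlue.monotone h1)
            simp [expNegInvGlue]
          · rw [indicator_of_notMem hx, norm_zero]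
            exact norm_nonneg _
  refine hlow.trans (hSob.trans ?_)
  rw [mul_assoc]
  gcongr
  refine (eLpNorm_add_le ?_ ?_ hp1).trans ((add_le_add hE2 hE1).trans ?_)
  · exact ((hgd.continuous.measurable.comp h.measurable_fun).aestronglyMeasurable).smul
      (hζ.contDiff.continuous_gradient (by norm_cast)).aestronglyMeasurable
  · exact ((hζ.contDiff.continuous.measurable.mul
        ((measurable_deriv g).comp h.measurable_fun)).aestronglyMeasurable).smul h.memLp_grad.1
  · rw [← add_mul, ← ENNReal.ofReal_add hL (by positivity)]
    gcongr
    have : L ≤ L * T ^ 2 := le_mul_of_one_le_right hL (one_le_pow₀ hT)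
    linarith

end IsRegularizedSupersolution

/-- Fast geometric convergence. -/
theorem le_mul_pow_of_fast_geometric {y : ℕ → ℝ} {C B α θ ε : ℝ} (hy : ∀ j, 0 ≤ y j) (hC : 0 ≤ C)
    (hB : 0 ≤ B) (hα : 0 < α) (hθ : 0 ≤ θ) (hε : 0 ≤ ε)
    (hstep : ∀ j, y (j + 1) ≤ C * B ^ j * y j ^ (1 + α)) (hBθ : B * θ ^ α ≤ 1)
    (hCε : C * ε ^ α ≤ θ) (h0 : y 0 ≤ ε) (j : ℕ) : y j ≤ ε * θ ^ j := by
  induction j with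
  | zero => simpa using h0
  | succ j ih =>
    have h1 : (ε * θ ^ j) ^ (1 + α) = ε * θ ^ j * (ε ^ α * (θ ^ α) ^ j) := by
      rw [add_comm, Real.rpow_add_one' (by positivity) (by linarith),
        Real.mul_rpow hε (by positivity), ← Real.rpow_natCast, ← Real.rpow_mul hθ,
        mul_comm (j : ℝ) α, Real.rpow_mul hθ, Real.rpow_natCast, Real.rpow_natCast]
      ring
    calc y (j + 1) ≤ C * B ^ j * y j ^ (1 + α) := hstep j
      _ ≤ C * B ^ j * (ε * θ ^ j) ^ (1 + α) := by
          gcongr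
          exact hy j
      _ = (C * ε ^ α) * (B * θ ^ α) ^ j * (ε * θ ^ j) := by rw [h1, mul_pow]; ring
      _ ≤ θ * 1 * (ε * θ ^ j) := by
          gcongr
          exact pow_le_one₀ (by positivity) hBθ
      _ = ε * θ ^ (j + 1) := by ring

/-- De Giorgi's lemma: a nonnegative supersolution which is below `k` only on a small set is at
least `k / 2` in a smaller cube. -/
theorem exists_deGiorgi (N : ℕ) {p C₀ C₁ : ℝ} (hp : 1 < p) (hpN : p < N) (hC₀ : 0 < C₀)
    (hC₁ : 0 < C₁) :
    ∃ ν : ℝ, 0 < ν ∧ ∀ r : ℝ, 0 < r → ∀ (v : EuclideanSpace ℝ (Fin N) → ℝ)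
      (V a : EuclideanSpace ℝ (Fin N) → EuclideanSpace ℝ (Fin N))
      (w : ℕ → EuclideanSpace ℝ (Fin N) → ℝ),
      IsRegularizedSupersolution (closedCube N (7 / 4 * r)) p C₀ C₁ v V a w →
      ∀ k : ℝ, 0 < k → volume.real (cube N (3 / 2 * r) ∩ {x | v x < k}) ≤ ν * r ^ N →
        ∀ᵐ x ∂volume.restrict (cube N r), k / 2 ≤ v x := by
  have hp0 : 0 < p := by linarith
  have hN0 : (0 : ℝ) < N := by linarith
  have hN : 0 < N := by exact_mod_cast hN0
  obtain ⟨L, hL, hcut⟩ := exists_cutoff N hp.le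
  have hq' : 0 < p⁻¹ - (N : ℝ)⁻¹ := sub_pos.2 (inv_strictAnti₀ hp0 hpN)
  -- The Sobolev conjugate exponent. Its excess over `p`, in the form `q / p = 1 + q / N`, is the
  -- superlinear gain of the iteration.
  set q : ℝ := (p⁻¹ - (N : ℝ)⁻¹)⁻¹ with hq
  have hq0 : 0 < q := inv_pos.2 hq'
  have hqi : ((q.toNNReal : NNReal) : ℝ)⁻¹ = p⁻¹ - (N : ℝ)⁻¹ := by
    rw [Real.coe_toNNReal _ hq0.le, hq, inv_inv]
  have hqp : q / p = 1 + q / N := by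
    have : q * (p⁻¹ - (N : ℝ)⁻¹) = 1 := inv_mul_cancel₀ hq'.ne'
    rw [div_eq_mul_inv, div_eq_mul_inv]; linarith
  set Cs : ℝ := ((SNormLESNormFDerivOfEqConst ℝ
    (volume : Measure (EuclideanSpace ℝ (Fin N))) p : NNReal) : ℝ) with hCs
  have hCs0 : 0 ≤ Cs := NNReal.coe_nonneg _
  -- At step `j` the cutoff gradient contributes `16 * L * 2 ^ j / r` and `T ^ 2` contributes `16 *
  -- 4 ^ j`, whence 256 and a growth rate 8. Then `θ = 8^(-N)` gives `8 ^ q * θ ^ (q/N) = 1`, and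
  -- the critical density is the value of `ν` with `(D / r) ^ q * (ν * r ^ N) ^ (q/N) = θ`.
  set D : ℝ := Real.exp 1 * ((Cs + 1) * (256 * L * (1 + 2 * C₁ / C₀))) with hD
  have hD0 : 0 < D := by positivity
  set θ : ℝ := (1 / 8) ^ N with hθ
  have hθ0 : 0 < θ := by positivity
  refine ⟨(θ / D ^ q) ^ (N / q), by positivity, fun r hr v V a w h k hk hsmall => ?_⟩
  -- Sides shrink from `5r/4` to `r` and levels from `k` to `k/2`.
  set ρ : ℕ → ℝ := fun j => r * (1 + (1 / 2) ^ j / 4) with hρ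
  set κ : ℕ → ℝ := fun j => k / 2 * (1 + (1 / 2) ^ j) with hκ
  set y : ℕ → ℝ := fun j => volume.real (closedCube N (ρ j) ∩ {x | v x < κ j}) with hy
  have hpow1 : ∀ j : ℕ, ((1 : ℝ) / 2) ^ j ≤ 1 := fun j => pow_le_one₀ (by norm_num) (by norm_num)
  have hfin : ∀ (s : ℝ) (A : Set (EuclideanSpace ℝ (Fin N))), volume (closedCube N s ∩ A) ≠ ⊤ :=
    fun s A => measure_ne_top_of_subset inter_subset_left
      (isCompact_closedCube N s).measure_lt_top.ne
  have hstep : ∀ j, y (j + 1) ≤ (D / r) ^ q * (8 ^ q) ^ j * y j ^ (1 + q / N) := by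
    intro j
    have hj : (0 : ℝ) < (1 / 2) ^ j := by positivity
    have hlt : ρ (j + 1) < ρ j := by
      simp only [hρ, pow_succ]
      gcongr
      linarith
    -- The midpoint is used because `ζ = 1` is known only on an open cube, while the closed cube of
    -- side `ρ (j + 1)` must be covered.
    obtain ⟨ζ, hζ, hζ0, hζ1, hζr, hζL⟩ := hcut ((ρ (j + 1) + ρ j) / 2) (ρ j) (by linarith)
    have h2 : (2 : ℝ) ^ j = ((1 / 2) ^ j)⁻¹ := by rw [one_div, inv_pow, inv_inv]
    have hLj : L / (ρ j - (ρ (j + 1) + ρ j) / 2) = 16 * L * 2 ^ j / r := by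
      rw [h2]
      simp only [hρ, pow_succ]
      generalize ((1 : ℝ) / 2) ^ j = e at hj
      rw [show r * (1 + e / 4) - (r * (1 + e * (1 / 2) / 4) + r * (1 + e / 4)) / 2 = r * e / 16 by
        ring]
      field_simp
    rw [hLj] at hζL
    have hstep := h.volume_sublevel_step hp hC₀ hC₁ hN hqi (by simpa using hq0) (r₁ := ρ (j + 1))
      (κ := κ j) (δ := k / 4 * (1 / 2) ^ j) (T := 4 * 2 ^ j) hζ hζ0 hζ1
      (fun x hx => hζr x (closedCube_subset_cube N (by linarith) hx)) (by positivity) hζL hlt.le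
      (closedCube_subset_closedCube N (by
        simp only [hρ]; nlinarith [hpow1 j]))
      (by positivity)
      (by have : (1 : ℝ) ≤ 2 ^ j := one_le_pow₀ (by norm_num)
          linarith)
      (by rw [h2]
          simp only [hκ]
          field_simp
          linarith [hpow1 j])
    have hκj : κ j - k / 4 * (1 / 2) ^ j = κ (j + 1) := by
      simp only [hκ, pow_succ]; ring
    rw [hκj] at hstep
    have hreal := ENNReal.toReal_mono (ENNReal.mul_ne_top (ENNReal.mul_ne_top ENNReal.coe_ne_top
      ENNReal.ofReal_ne_top) (ENNReal.rpow_ne_top_of_nonneg (by positivity) (hfin _ _))) hstep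
    rw [ENNReal.toReal_mul, ENNReal.toReal_mul, ENNReal.toReal_mul,
      ENNReal.toReal_ofReal (by positivity), ENNReal.toReal_ofReal (by positivity),
      ← ENNReal.toReal_rpow, ← ENNReal.toReal_rpow, ENNReal.coe_toReal,
      Real.coe_toNNReal _ hq0.le] at hreal
    change Real.exp (-1) * y (j + 1) ^ (1 / q) ≤ Cs * _ * y j ^ (1 / p) at hreal
    have hy1 : 0 ≤ y (j + 1) := measureReal_nonneg
    have hy0 : 0 ≤ y j := measureReal_nonneg
    have hroot : y (j + 1) ^ (1 / q) ≤ D / r * 8 ^ j * y j ^ (1 / p) := by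
      have e1 : Real.exp 1 * Real.exp (-1) = 1 := by rw [← Real.exp_add]; simp
      calc y (j + 1) ^ (1 / q) = Real.exp 1 * (Real.exp (-1) * y (j + 1) ^ (1 / q)) := by
            rw [← mul_assoc, e1, one_mul]
        _ ≤ Real.exp 1 * (Cs * (16 * L * 2 ^ j / r * (1 + 2 * C₁ / C₀) * (4 * 2 ^ j) ^ 2) *
              y j ^ (1 / p)) := by gcongr
        _ ≤ Real.exp 1 * ((Cs + 1) * (16 * L * 2 ^ j / r * (1 + 2 * C₁ / C₀) *
              (4 * 2 ^ j) ^ 2) * y j ^ (1 / p)) := by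
            gcongr
            linarith
        _ = _ := by
            rw [hD, show (8 : ℝ) ^ j = 2 ^ j * 2 ^ j * 2 ^ j by
              rw [← mul_pow, ← mul_pow]; norm_num]
            ring
    calc y (j + 1) = (y (j + 1) ^ (1 / q)) ^ q := by
          rw [← Real.rpow_mul hy1, one_div_mul_cancel hq0.ne', Real.rpow_one]
      _ ≤ (D / r * 8 ^ j * y j ^ (1 / p)) ^ q := by gcongr
      _ = _ := by
          rw [Real.mul_rpow (by positivity) (by positivity), Real.mul_rpow (by positivity)
            (by positivity), ← Real.rpow_mul hy0, ← hqp, one_div_mul_eq_div,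
            ← Real.rpow_natCast, ← Real.rpow_natCast, ← Real.rpow_mul (by norm_num),
            ← Real.rpow_mul (by norm_num), mul_comm (j : ℝ) q]
  have hgeo := le_mul_pow_of_fast_geometric (y := y) (C := (D / r) ^ q) (B := 8 ^ q)
    (α := q / N) (θ := θ) (ε := (θ / D ^ q) ^ (N / q) * r ^ N)
    (fun j => measureReal_nonneg) (by positivity) (by positivity) (by positivity) hθ0.le
    (by positivity) hstep
    (by
      rw [hθ, ← Real.rpow_natCast, ← Real.rpow_mul (by norm_num), mul_div_cancel₀ _ hN0.ne',
        ← Real.mul_rpow (by norm_num) (by norm_num)]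
      norm_num)
    (by
      rw [Real.mul_rpow (by positivity) (by positivity), ← Real.rpow_mul (by positivity),
        ← Real.rpow_natCast r N, ← Real.rpow_mul hr.le, mul_div_cancel₀ _ hN0.ne',
        show (N : ℝ) / q * (q / N) = 1 by field_simp, Real.rpow_one,
        Real.div_rpow hD0.le hr.le]
      have := Real.rpow_pos_of_pos hr q
      have := Real.rpow_pos_of_pos hD0 q
      exact le_of_eq (by field_simp))
    (by
      refine le_trans (measureReal_mono ?_ (measure_ne_top_of_subset inter_subset_left
        (by rw [volume_cube]; exact ENNReal.pow_ne_top ENNReal.ofReal_ne_top))) hsmall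
      refine inter_subset_inter (closedCube_subset_cube N (by simp only [hρ]; linarith))
        fun x hx => ?_
      have : v x < κ 0 := hx
      simp only [hκ, pow_zero] at this
      change v x < k
      linarith)
  have hzero : volume.real (cube N r ∩ {x | v x < k / 2}) = 0 := by
    refine le_antisymm ?_ measureReal_nonneg
    have hlim : Tendsto (fun j : ℕ => (θ / D ^ q) ^ (N / q) * r ^ N * θ ^ j) atTop (𝓝 0) := by
      have hθ1 : θ < 1 := pow_lt_one₀ (by norm_num) (by norm_num) hN.ne'
      simpa using (tendsto_pow_atTop_nhds_zero_of_lt_one hθ0.le hθ1).const_mul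
        ((θ / D ^ q) ^ (N / q) * r ^ N)
    refine ge_of_tendsto' hlim fun j => le_trans (measureReal_mono ?_ (hfin _ _)) (hgeo j)
    have hj : (0 : ℝ) < (1 / 2) ^ j := by positivity
    refine inter_subset_inter (cube_subset_closedCube N ?_) fun x hx => ?_
    · simp only [hρ]; nlinarith
    · have : v x < k / 2 := hx
      change v x < k / 2 * (1 + (1 / 2) ^ j)
      nlinarith
  have hQfin : volume (cube N r ∩ {x | v x < k / 2}) ≠ ⊤ :=
    measure_ne_top_of_subset inter_subset_left
      (by rw [volume_cube]; exact ENNReal.pow_ne_top ENNReal.ofReal_ne_top)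
  rw [ae_restrict_iff' (isOpen_cube N r).measurableSet, ae_iff]
  rw [measureReal_eq_zero_iff hQfin] at hzero
  refine measure_mono_null (fun x hx => ?_) hzero
  simpa using hx

/-! ### Expansion of positivity -/

theorem volumeReal_cube (N : ℕ) {r : ℝ} (hr : 0 ≤ r) : volume.real (cube N r) = r ^ N := by
  rw [Measure.real, volume_cube, ENNReal.toReal_pow, ENNReal.toReal_ofReal hr]

/-- Expansion of positivity in a fixed cube. -/
theorem exists_expansion_of_positivity (N : ℕ) {p C₀ C₁ : ℝ} (hp : 1 < p) (hpN : p < N)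
    (hC₀ : 0 < C₀) (hC₁ : 0 < C₁) {ν : ℝ} (hν : 0 < ν) :
    ∃ c : ℝ, 0 < c ∧ c < 1 ∧ ∀ (R : ℝ) (u : EuclideanSpace ℝ (Fin N) → ℝ),
      (∀ᵐ x ∂volume.restrict (cube N R), 0 ≤ u x) → IsSupersolution (cube N R) p C₀ C₁ u →
      ∀ r : ℝ, 0 < r → r ≤ R / 2 → ∀ t : ℝ, 0 < t →
        ν * r ^ N ≤ volume.real (cube N r ∩ {x | t ≤ u x}) →
          ∀ᵐ x ∂volume.restrict (cube N r), c * t ≤ u x := by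
  obtain ⟨ν₀, hν₀, hDG⟩ := exists_deGiorgi N hp hpN hC₀ hC₁
  obtain ⟨C, hC, hlog⟩ := exists_log_estimate N hp hC₀ hC₁
  -- Chosen so that `log (1 / (2 ε)) = C / (ν * ν₀)`: the logarithmic estimate at `k = ε t` then
  -- brings the sublevel set down to the critical density `ν₀`.
  set ε : ℝ := Real.exp (-(C / (ν * ν₀))) / 2 with hε
  have hε0 : 0 < ε := by positivity
  have hε1 : ε ≤ 1 / 2 := by
    have : Real.exp (-(C / (ν * ν₀))) ≤ 1 := by
      rw [Real.exp_le_one_iff, neg_nonpos]; positivity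
    rw [hε]; linarith
  refine ⟨ε / 2, by positivity, by linarith, fun R u hu0 hu r hr hrR t ht hmass => ?_⟩
  obtain ⟨v, V, a, w, hvu, h⟩ := hu.exists_isRegularizedSupersolution hp.le hu0 (isOpen_cube N R)
    (isCompact_closedCube N (7 / 4 * r)) (closedCube_subset_cube N (by linarith))
  have hsub : cube N r ⊆ closedCube N (7 / 4 * r) := cube_subset_closedCube N (by linarith)
  have hvu' : v =ᵐ[volume.restrict (cube N r)] u := ae_restrict_of_ae_restrict_of_subset hsub hvu
  have hcm : MeasurableSet (cube N r) := (isOpen_cube N r).measurableSet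
  set A := volume.real (cube N (3 / 2 * r) ∩ {x | t ≤ v x}) with hA
  set B := volume.real (cube N (3 / 2 * r) ∩ {x | v x < ε * t}) with hB
  have hB0 : 0 ≤ B := measureReal_nonneg
  have hAν : ν * r ^ N ≤ A := by
    have e : volume.real (cube N r ∩ {x | t ≤ u x}) = volume.real (cube N r ∩ {x | t ≤ v x}) := by
      refine measureReal_congr ?_
      rw [Filter.EventuallyEq, ae_restrict_iff' hcm] at hvu'
      filter_upwards [hvu'] with x hx
      refine propext (and_congr_right fun hxm => ?_)
      change t ≤ u x ↔ t ≤ v x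
      rw [hx hxm]
    refine (hmass.trans_eq e).trans (measureReal_mono ?_ (measure_ne_top_of_subset
      inter_subset_left (by rw [volume_cube]; exact ENNReal.pow_ne_top ENNReal.ofReal_ne_top)))
    exact inter_subset_inter_left _ (cube_subset_cube N (by linarith))
  have hle := hlog r hr v V a w h (ε * t) t (by positivity) (by nlinarith)
  have hl : C / (ν * ν₀) ≤ Real.log ((t + ε * t) / (2 * (ε * t))) := by
    rw [Real.le_log_iff_exp_le (by positivity)]
    have e1 : 2 * ε = (Real.exp (C / (ν * ν₀)))⁻¹ := by rw [hε, Real.exp_neg]; ring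
    have e2 : Real.exp (C / (ν * ν₀)) * (2 * ε) = 1 := by
      rw [e1]; exact mul_inv_cancel₀ (Real.exp_pos _).ne'
    rw [le_div_iff₀ (by positivity)]
    calc Real.exp (C / (ν * ν₀)) * (2 * (ε * t)) = (Real.exp (C / (ν * ν₀)) * (2 * ε)) * t := by
          ring
      _ ≤ t + ε * t := by rw [e2]; nlinarith
  have hBsmall : B ≤ ν₀ * r ^ N := by
    have hrN : 0 < r ^ N := by positivity
    have h1 : ν * r ^ N * B * (C / (ν * ν₀)) ≤ C * (r ^ N) ^ 2 := by
      refine le_trans ?_ hle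
      gcongr
    have h2 : ν * r ^ N * B * (C / (ν * ν₀)) = (C * r ^ N) * (B / ν₀) := by field_simp
    have h3 : C * (r ^ N) ^ 2 = (C * r ^ N) * r ^ N := by ring
    rw [h2, h3] at h1
    have h4 := le_of_mul_le_mul_left h1 (by positivity)
    rw [div_le_iff₀ hν₀] at h4
    linarith
  filter_upwards [hDG r hr v V a w h (ε * t) (by positivity) hBsmall, hvu'] with x h1 h2
  rw [← h2]
  linarith

/-- Iterated expansion of positivity along doubling cubes. -/
theorem ae_le_of_expansion_iterate {N : ℕ} {c₀ c₁ R r : ℝ}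
    {u : EuclideanSpace ℝ (Fin N) → ℝ} (hr : 0 < r) (hc₀ : 0 < c₀) (hc₁ : 0 < c₁)
    (hexp : ∀ s : ℝ, 0 < s → s ≤ R / 2 → ∀ t : ℝ, 0 < t →
      (1 / 2) ^ N * s ^ N ≤ volume.real (cube N s ∩ {x | t ≤ u x}) →
        ∀ᵐ x ∂volume.restrict (cube N s), c₀ * t ≤ u x)
    (hbase : ∀ᵐ x ∂volume.restrict (cube N r), c₁ ≤ u x) (n : ℕ) :
    ∀ ρ : ℝ, r ≤ ρ → ρ ≤ 2 ^ n * r → ρ ≤ R / 2 →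
      ∀ᵐ x ∂volume.restrict (cube N ρ), c₁ * c₀ ^ n ≤ u x := by
  induction n with
  | zero =>
    intro ρ h1 h2 _
    obtain rfl : ρ = r := le_antisymm (by simpa using h2) h1
    simpa using hbase
  | succ n ih =>
    intro ρ h1 h2 h3
    have hρ : 0 < ρ := hr.trans_le h1
    have hpow : (1 : ℝ) ≤ 2 ^ n := one_le_pow₀ (by norm_num)
    have hs := ih (max (ρ / 2) r) (le_max_right _ _)
      (max_le (by rw [pow_succ] at h2; linarith) (by nlinarith))
      (max_le (by linarith) (by linarith))
    -- Half the side would suffice for the fraction `2^(-N)`; the maximum keeps `s ≥ r`, as the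
    -- induction hypothesis demands, when `ρ < 2 r`.
    set s := max (ρ / 2) r with hsdef
    have hsρ : s ≤ ρ := max_le (by linarith) h1
    have hs0 : 0 ≤ s := hr.le.trans (le_max_right _ _)
    have := hexp ρ hρ h3 (c₁ * c₀ ^ n) (by positivity) (by
      calc (1 / 2) ^ N * ρ ^ N = (ρ / 2) ^ N := by rw [← mul_pow]; ring
        _ ≤ s ^ N := by gcongr; exact le_max_left _ _
        _ = volume.real (cube N s) := (volumeReal_cube N hs0).symm
        _ = volume.real (cube N s ∩ {x | c₁ * c₀ ^ n ≤ u x}) := by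
            refine measureReal_congr ?_
            rw [ae_restrict_iff' (isOpen_cube N s).measurableSet] at hs
            filter_upwards [hs] with x hx
            exact propext ⟨fun h => ⟨h, hx h⟩, fun h => h.1⟩
        _ ≤ _ := measureReal_mono (inter_subset_inter_left _ (cube_subset_cube N hsρ))
            (measure_ne_top_of_subset inter_subset_left
              (by rw [volume_cube]; exact ENNReal.pow_ne_top ENNReal.ofReal_ne_top)))
    filter_upwards [this] with x hx
    rw [pow_succ]
    linarith

/-- In `ℝ` the essential infimum is meaningful only if the a.e. lower bounds are bounded above. For
a nonzero measure this holds because a real-valued function cannot exceed every natural number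
almost everywhere. -/
theorem le_essInf_of_ae_le_real {α : Type*} [MeasurableSpace α] {μ : Measure α} (hμ : μ ≠ 0)
    {u : α → ℝ} {c : ℝ} (h : ∀ᵐ x ∂μ, c ≤ u x) : c ≤ essInf u μ := by
  have : NeBot (ae μ) := ae_neBot.2 hμ
  refine le_liminf_of_le ?_ h
  obtain ⟨b, hb⟩ : ∃ b : ℕ, ∃ᶠ x in ae μ, u x ≤ b := by
    by_contra! hcon
    obtain ⟨x, hx⟩ := (ae_all_iff.2 hcon).exists
    obtain ⟨n, hn⟩ := exists_nat_ge (u x)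
    exact absurd (hx n) (not_lt.2 hn)
  exact IsCoboundedUnder.of_frequently_le hb

theorem mainTheorem10 (N : ℕ) (p : ℝ) (hp : 1 < p) (hpN : p < N) (C₀ C₁ : ℝ) (hC₀ : 0 < C₀)
    (hC₁ : 0 < C₁) :
    ∃ lam : ℝ, 1 < lam ∧ ∀ μ : ℝ, 0 < μ → ∃ c : ℝ, 0 < c ∧
      ∀ (R : ℝ) (_ : 0 < R) (u : EuclideanSpace ℝ (Fin N) → ℝ),
        (∀ᵐ x ∂volume.restrict (cube N R), 0 ≤ u x) →
        IsSupersolution (cube N R) p C₀ C₁ u →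
        ∀ r ρ : ℝ, 0 < r → r ≤ ρ → ρ ≤ R / 2 →
          μ ≤ superlevelFraction (cube N r) u 1 →
            c * (r / ρ) ^ lam ≤ essInf u (volume.restrict (cube N ρ)) := by
  -- The doubling constant is fixed before `μ` is introduced, so the exponent cannot depend on `μ`.
  -- The maximum with 2 only secures an exponent above 1; enlarging it is harmless as `r / ρ ≤ 1`.
  obtain ⟨c₀, hc₀, hc₀1, hexp⟩ := exists_expansion_of_positivity N hp hpN hC₀ hC₁
    (ν := (1 / 2) ^ N) (by positivity)
  refine ⟨max (Real.logb 2 c₀⁻¹) 2, lt_max_of_lt_right one_lt_two, fun μ hμ => ?_⟩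
  obtain ⟨c₁, hc₁, -, hbase⟩ := exists_expansion_of_positivity N hp hpN hC₀ hC₁ hμ
  refine ⟨c₁ * c₀, by positivity, fun R _ u hu0 hu r ρ hr hrρ hρR hfrac => ?_⟩
  have hρ : 0 < ρ := hr.trans_le hrρ
  have hx1 : 1 ≤ ρ / r := (one_le_div hr).2 hrρ
  have hmass : μ * r ^ N ≤ volume.real (cube N r ∩ {x | 1 ≤ u x}) := by
    rwa [superlevelFraction, volumeReal_cube N hr.le, le_div_iff₀ (by positivity)] at hfrac
  have h1 := hbase R u hu0 hu r hr (hrρ.trans hρR) 1 one_pos hmass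
  rw [mul_one] at h1
  set n := ⌈Real.logb 2 (ρ / r)⌉₊ with hn
  have hlog0 : 0 ≤ Real.logb 2 (ρ / r) := Real.logb_nonneg one_lt_two hx1
  have hn1 : ρ ≤ 2 ^ n * r := by
    rw [← div_le_iff₀ hr, ← Real.rpow_natCast, ← Real.logb_le_iff_le_rpow one_lt_two (by positivity)]
    exact Nat.le_ceil _
  -- Rounding up costs at most one extra factor `c₀`, already included in the constant `c₁ * c₀`.
  have hn2 : (n : ℝ) ≤ Real.logb 2 (ρ / r) + 1 := (Nat.ceil_lt_add_one hlog0).le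
  have hae := ae_le_of_expansion_iterate hr hc₀ hc₁
    (hexp R u hu0 hu) h1 n ρ hrρ hn1 hρR
  have hQ0 : volume.restrict (cube N ρ) ≠ 0 := by
    rw [Ne, Measure.restrict_eq_zero, volume_cube]
    exact pow_ne_zero _ (by simpa using hρ)
  refine le_trans ?_ (le_essInf_of_ae_le_real hQ0 hae)
  rw [mul_assoc]
  gcongr c₁ * ?_
  have h3 : c₀ * c₀ ^ Real.logb 2 (ρ / r) ≤ c₀ ^ n := by
    rw [mul_comm, ← Real.rpow_add_one hc₀.ne', ← Real.rpow_natCast]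
    exact Real.rpow_le_rpow_of_exponent_ge hc₀ hc₀1.le hn2
  refine le_trans ?_ h3
  gcongr c₀ * ?_
  have h4 : c₀ ^ Real.logb 2 (ρ / r) = (r / ρ) ^ Real.logb 2 c₀⁻¹ := by
    have ex : (r / ρ) = 2 ^ (-Real.logb 2 (ρ / r)) := by
      rw [← Real.logb_inv, inv_div, Real.rpow_logb two_pos (by norm_num) (by positivity)]
    have ec : c₀ = 2 ^ (-Real.logb 2 c₀⁻¹) := by
      rw [← Real.logb_inv, inv_inv, Real.rpow_logb two_pos (by norm_num) hc₀]
    rw [ex, ← Real.rpow_mul two_pos.le]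
    conv_lhs => rw [ec]
    rw [← Real.rpow_mul two_pos.le]
    congr 1; ring
  rw [h4]
  exact Real.rpow_le_rpow_of_exponent_ge (by positivity) ((div_le_one hρ).2 hrρ) (le_max_left _ _)
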